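/- Let $v_g,\kappa,\Gamma\in\mathbb R$ and let $s\ge 1$ be an integer. Consider the nonlinear coupled mode equations (NLCME) for complex-valued $E_\pm(Z,T)$, $Z\in\mathbb R$: $$i(\partial_T E_+ + v_g\,\partial_Z E_+)+\kappa E_- +\Gamma\,(|E_+|^2+2|E_-|^2)E_+=0,$$ $$i(\partial_T E_- - v_g\,\partial_Z E_-)+\kappa E_+ +\Gamma\,(|E_-|^2+2|E_+|^2)E_-=0.$$ For $\vec E=(E_+,E_-)$ write $\|\vec E\|_{H^s}^2=\sum_{k=0}^{s}\big(\|\partial_Z^kE_+\|_{L^2(\mathbb R)}^2+\|\partial_Z^kE_-\|_{L^2(\mathbb R)}^2\big)$, with weak derivatives. A solution on $[0,T]$ is a function $\vec E\in C([0,T];H^1(\mathbb R))$ that is differentiable in time with values in $L^2(\mathbb R)$ and satisfies both equations in $L^2(\mathbb R)$ at every time in $[0,T]$. Then there is a function $C_s:\mathbb R\times\mathbb R\to\mathbb R$ (depending only on $s,v_g,\kappa,\Gamma$) such that for every $T\ge 0$ one has $C_s(x,T)\to 0$ as $x\to 0$, $x\ge 0$, and such that for every $T\ge0$ and every solution $\vec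 E$ of NLCME on $[0,T]$ with $\vec E(0)\in H^s(\mathbb R)$ one has $\vec E(T)\in H^s(\mathbb R)$ and $$\|\vec E(T)\|_{H^s}\le C_s\big(\|\vec E(0)\|_{H^s},T\big).$$ -/

import Mathlib

open MeasureTheory Filter Topology Set
open scoped ContDiff

/-- The complex space `L²(ℝ)` (Lebesgue measure). -/
abbrev L2C : Type := Lp ℂ 2 (volume : Measure ℝ)

/-- `g ∈ L²(ℝ)` is the weak derivative of `f ∈ L²(ℝ)`: `∫ φ' f = - ∫ φ g` for every
(real-valued) test function `φ ∈ C_c^∞(ℝ)`. -/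
def HasWeakDeriv (f g : L2C) : Prop :=
  ∀ φ : ℝ → ℝ, ContDiff ℝ ∞ φ → HasCompactSupport φ →
    ∫ z, deriv φ z • f z = - ∫ z, φ z • g z

/-- Weak derivatives are unique. -/
theorem HasWeakDeriv.unique {f g h : L2C} (hg : HasWeakDeriv f g) (hh : HasWeakDeriv f h) :
    g = h := by
  have hgl : LocallyIntegrable (fun z => g z) (volume : Measure ℝ) :=
    (Lp.memLp g).locallyIntegrable (by norm_num)
  have hhl : LocallyIntegrable (fun z => h z) (volume : Measure ℝ) :=
    (Lp.memLp h).locallyIntegrable (by norm_num)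
  apply Lp.ext
  refine ae_eq_of_integral_contDiff_smul_eq hgl hhl ?_
  intro φ hφ hc
  exact neg_injective ((hg φ hφ hc).symm.trans (hh φ hφ hc))

open Classical in
/-- The weak derivative `∂_Z f ∈ L²(ℝ)`, where it exists (and `0` otherwise). -/
noncomputable def weakDeriv (f : L2C) : L2C :=
  if h : ∃ g, HasWeakDeriv f g then h.choose else 0

theorem HasWeakDeriv.weakDeriv_eq {f g : L2C} (h : HasWeakDeriv f g) : weakDeriv f = g := by
  have hex : ∃ g, HasWeakDeriv f g := ⟨g, h⟩
  rw [weakDeriv, dif_pos hex]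
  exact hex.choose_spec.unique h

/-- `f ∈ H^s(ℝ)`: `f` and its first `s` weak derivatives exist in `L²(ℝ)`. -/
def MemHs : ℕ → L2C → Prop
  | 0, _ => True
  | s + 1, f => ∃ g, HasWeakDeriv f g ∧ MemHs s g

/-- The `H^s` norm of a pair `(f₁, f₂)` of elements of `H^s(ℝ)`:
`‖(f₁, f₂)‖² = ∑_{k ≤ s} (‖∂^k f₁‖² + ‖∂^k f₂‖²)`, with `L²` norms on the right. -/
noncomputable def hsNorm (s : ℕ) (f₁ f₂ : L2C) : ℝ :=
  Real.sqrt (∑ k ∈ Finset.range (s + 1),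
    (‖weakDeriv^[k] f₁‖ ^ 2 + ‖weakDeriv^[k] f₂‖ ^ 2))

/-- `T ↦ (Ep T, Em T)` is a solution on the time interval `I` of the nonlinear coupled mode
equations with group velocity `v`, coupling `κ` and nonlinearity parameter `Γ`,
`i (∂_T Ep + v ∂_Z Ep) + κ Em + Γ (|Ep|² + 2 |Em|²) Ep = 0`,
`i (∂_T Em - v ∂_Z Em) + κ Ep + Γ (|Em|² + 2 |Ep|²) Em = 0`,
of class `C(I; H¹)`: it is a continuous function of time with values in `H¹(ℝ)` (that is, it and
its weak `Z`-derivative are continuous with values in `L²(ℝ)`), it is differentiable in time with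
values in `L²(ℝ)`, and the equations hold in `L²(ℝ)` at every time in `I`. -/
structure IsNLCMESolutionOn (v κ Γ : ℝ) (I : Set ℝ) (Ep Em : ℝ → L2C) : Prop where
  memH1_p : ∀ t ∈ I, MemHs 1 (Ep t)
  memH1_m : ∀ t ∈ I, MemHs 1 (Em t)
  continuousOn_p : ContinuousOn Ep I
  continuousOn_m : ContinuousOn Em I
  continuousOn_deriv_p : ContinuousOn (fun t => weakDeriv (Ep t)) I
  continuousOn_deriv_m : ContinuousOn (fun t => weakDeriv (Em t)) I
  eq_p : ∀ t ∈ I, ∃ Ept : L2C, HasDerivWithinAt Ep Ept I t ∧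
    ∀ᵐ z : ℝ, Complex.I * (Ept z + (v : ℂ) * weakDeriv (Ep t) z) + (κ : ℂ) * Em t z
      + (Γ : ℂ) * ((‖Ep t z‖ ^ 2 + 2 * ‖Em t z‖ ^ 2 : ℝ) : ℂ) * Ep t z = 0
  eq_m : ∀ t ∈ I, ∃ Emt : L2C, HasDerivWithinAt Em Emt I t ∧
    ∀ᵐ z : ℝ, Complex.I * (Emt z - (v : ℂ) * weakDeriv (Em t) z) + (κ : ℂ) * Ep t z
      + (Γ : ℂ) * ((‖Em t z‖ ^ 2 + 2 * ‖Ep t z‖ ^ 2 : ℝ) : ℂ) * Em t z = 0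

/-! The nonlinearity acts as multiplication by a real function times `i`, so it cannot change the
pointwise moduli `|E_±|`; only the coupling `κ` can, at a rate of at most `|κ|`. Hence, after
damping by `e^{-|κ|t}`, the convex set of pairs bounded by `m` is invariant: transport preserves the
distance to it, the nonlinear term is orthogonal to the direction of projection, and damping
dominates coupling. With `m` taken from the Sobolev inequality at time 0 this gives an `L^∞` bound,
and with `m = 0` an `L²` bound, both linear in the size of the data
(`IsNLCMESolutionOn.sq_norm_l2Excess_le`).

Higher regularity follows by induction on the order. Since the solution is only known to be `H¹` at
later times, derivatives are replaced by iterated difference quotients, with bounds uniform in the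
steps; such bounds characterise `H^s` (`memHs_of_norm_diffQuots_le`). Once the norms of stage `k`
are bounded by `M`, the cubic terms differenced `k + 1` times are affine in the next unknown norm,
because at most one factor can carry the top order (`topBound_mul_le`). This closes a Grönwall
estimate whose coefficients depend only on `M`.

Every constant vanishes with the data: the first bound is linear in `x`, and each later one is a
continuous function of `x` and `M` that is zero at the origin. -/

/-! ### Translations and weak derivatives in `L²`. -/

/-- Translation `f ↦ f(· + h)` on `L²(ℝ)`. -/
noncomputable def shift (h : ℝ) : L2C →ₗᵢ[ℂ] L2C :=
  Lp.compMeasurePreservingₗᵢ ℂ (fun z => z + h) (measurePreserving_add_right volume h)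

theorem coeFn_shift (h : ℝ) (f : L2C) : shift h f =ᵐ[volume] fun z => f (z + h) :=
  Lp.coeFn_compMeasurePreserving f (measurePreserving_add_right volume h)

theorem shift_zero (f : L2C) : shift 0 f = f := by
  apply Lp.ext
  filter_upwards [coeFn_shift 0 f] with z hz
  simp [hz]

theorem ae_add_right {p : ℝ → Prop} (hp : ∀ᵐ z, p z) (h : ℝ) : ∀ᵐ z, p (z + h) :=
  (measurePreserving_add_right volume h).quasiMeasurePreserving.ae hp

theorem shift_shift (a b : ℝ) (f : L2C) : shift a (shift b f) = shift (a + b) f := by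
  apply Lp.ext
  filter_upwards [coeFn_shift a (shift b f), coeFn_shift (a + b) f,
    ae_add_right (coeFn_shift b f) a] with z h1 h2 h3
  rw [h1, h2, h3, add_assoc]

theorem continuous_shift (f : L2C) : Continuous fun h => shift h f := by
  refine Continuous.compMeasurePreservingLp (X := ℝ) (f := fun _ => f)
    (g := fun h : ℝ => (⟨fun z => z + h, by fun_prop⟩ : C(ℝ, ℝ))) continuous_const ?_
    (fun h => measurePreserving_add_right volume h) (by norm_num)
  exact ContinuousMap.continuous_of_continuous_uncurry _
    (show Continuous fun p : ℝ × ℝ => p.2 + p.1 by fun_prop)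

/-- The pairing of `f ∈ L²(ℝ)` with a real-valued function. -/
noncomputable def pairing (φ : ℝ → ℝ) (f : L2C) : ℂ := ∫ z, φ z • f z

theorem memLp_testFunction {φ : ℝ → ℝ} (hφ : Continuous φ) (hc : HasCompactSupport φ) :
    MemLp (fun z => (φ z : ℂ)) 2 (volume : Measure ℝ) :=
  (hφ.memLp_of_hasCompactSupport hc).ofReal

theorem pairing_eq_inner {φ : ℝ → ℝ} (hφ : Continuous φ) (hc : HasCompactSupport φ) (f : L2C) :
    pairing φ f = inner ℂ ((memLp_testFunction hφ hc).toLp _) f := by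
  rw [L2.inner_def, pairing]
  apply integral_congr_ae
  filter_upwards [(memLp_testFunction hφ hc).coeFn_toLp] with z hz
  rw [hz]
  simp [mul_comm]

theorem L2C.ext_pairing {f g : L2C}
    (h : ∀ φ : ℝ → ℝ, ContDiff ℝ ∞ φ → HasCompactSupport φ → pairing φ f = pairing φ g) :
    f = g := by
  apply Lp.ext
  exact ae_eq_of_integral_contDiff_smul_eq ((Lp.memLp f).locallyIntegrable (by norm_num))
    ((Lp.memLp g).locallyIntegrable (by norm_num)) h

theorem pairing_shift (φ : ℝ → ℝ) (h : ℝ) (f : L2C) :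
    pairing φ (shift h f) = ∫ z, φ (z - h) • f z := by
  rw [pairing, ← integral_add_right_eq_self (fun z => φ (z - h) • f z) h]
  apply integral_congr_ae
  filter_upwards [coeFn_shift h f] with z hz
  simp [hz]

/-- Up to reflecting `φ` this is a convolution, so the derivative falls on the smooth factor and
nothing is asked of `f` beyond `L²`. -/
theorem hasDerivAt_pairing_shift {φ : ℝ → ℝ} (hφ : ContDiff ℝ ∞ φ) (hc : HasCompactSupport φ)
    (f : L2C) (h : ℝ) :
    HasDerivAt (fun r => pairing φ (shift r f)) (-pairing (deriv φ) (shift h f)) h := by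
  have hloc : LocallyIntegrable (fun z => f z) (volume : Measure ℝ) :=
    (Lp.memLp f).locallyIntegrable (by norm_num)
  have hc' : HasCompactSupport (fun x => φ (-x)) := hc.comp_homeomorph (Homeomorph.neg ℝ)
  have hd : ContDiff ℝ 1 (fun x => φ (-x)) := (hφ.of_le (by simp)).comp contDiff_neg
  have := hc'.hasDerivAt_convolution_right (μ := volume)
    (ContinuousLinearMap.lsmul ℝ ℝ (E := ℂ)).flip hloc hd h
  convert! this using 1
  · ext r
    rw [pairing_shift]
    simp [convolution]
  · rw [pairing_shift, convolution, ← integral_neg]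
    congr 1
    ext z
    have : deriv (fun x => φ (-x)) (h - z) = - deriv φ (z - h) := by
      rw [deriv_comp_neg]; simp
    simp [this]

theorem HasWeakDeriv.hasDerivAt_pairing {f g : L2C} (hfg : HasWeakDeriv f g) {φ : ℝ → ℝ}
    (hφ : ContDiff ℝ ∞ φ) (hc : HasCompactSupport φ) (h : ℝ) :
    HasDerivAt (fun r => pairing φ (shift r f)) (pairing φ (shift h g)) h := by
  convert! hasDerivAt_pairing_shift hφ hc f h using 1
  have h1 : ContDiff ℝ ∞ (fun z => φ (z - h)) := hφ.comp (contDiff_id.sub contDiff_const)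
  have h2 : HasCompactSupport (fun z => φ (z - h)) := hc.comp_homeomorph (Homeomorph.subRight h)
  have := hfg _ h1 h2
  rw [pairing_shift, pairing_shift, ← neg_eq_iff_eq_neg, ← this]
  congr 1
  ext z
  rw [deriv_comp_sub_const]

theorem HasWeakDeriv.shift_sub_eq_integral {f g : L2C} (hfg : HasWeakDeriv f g) (h : ℝ) :
    shift h f - f = ∫ r in (0 : ℝ)..h, shift r g := by
  apply L2C.ext_pairing
  intro φ hφ hc
  rw [pairing_eq_inner hφ.continuous hc, pairing_eq_inner hφ.continuous hc, inner_sub_right]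
  have hi : IntervalIntegrable (fun r => shift r g) volume 0 h :=
    (continuous_shift g).intervalIntegrable _ _
  have := (innerSL ℂ ((memLp_testFunction hφ.continuous hc).toLp _)).intervalIntegral_comp_comm hi
  simp only [innerSL_apply_apply] at this
  rw [← this]
  have key := intervalIntegral.integral_eq_sub_of_hasDerivAt
    (fun r _ => hfg.hasDerivAt_pairing hφ hc r) (a := 0) (b := h) ?_
  · simp only [pairing_eq_inner hφ.continuous hc, shift_zero] at key
    exact key.symm
  · simp only [pairing_eq_inner hφ.continuous hc]
    exact (continuous_const.inner (continuous_shift g)).intervalIntegrable _ _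

theorem HasWeakDeriv.norm_shift_sub_le {f g : L2C} (hfg : HasWeakDeriv f g) (h : ℝ) :
    ‖shift h f - f‖ ≤ |h| * ‖g‖ := by
  rw [hfg.shift_sub_eq_integral]
  have := intervalIntegral.norm_integral_le_of_norm_le_const (a := 0) (b := h)
    (f := fun r => shift r g) (C := ‖g‖) (fun r _ => by simp)
  simpa [mul_comm] using this

/-- The weak derivative is the generator of the translation group. In this form it commutes with
bounded translation-invariant operators and can be used in differentiation of norms. -/
theorem hasWeakDeriv_iff_hasDerivAt {f g : L2C} :
    HasWeakDeriv f g ↔ HasDerivAt (fun h => shift h f) g 0 := by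
  constructor
  · intro hfg
    have h1 : HasDerivAt (fun h => ∫ r in (0 : ℝ)..h, shift r g) (shift 0 g) 0 :=
      intervalIntegral.integral_hasDerivAt_right ((continuous_shift g).intervalIntegrable _ _)
        ((continuous_shift g).stronglyMeasurableAtFilter _ _) (continuous_shift g).continuousAt
    rw [shift_zero] at h1
    have := h1.add_const f
    convert! this using 1
    ext1 h
    rw [← hfg.shift_sub_eq_integral, sub_add_cancel]
  · intro hd φ hφ hc
    have h1 := hasDerivAt_pairing_shift hφ hc f 0
    simp only [pairing_eq_inner hφ.continuous hc] at h1
    have h2 : HasDerivAt (fun r => inner ℂ ((memLp_testFunction hφ.continuous hc).toLp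
        (fun z => (φ z : ℂ))) (shift r f)) (inner ℂ ((memLp_testFunction hφ.continuous hc).toLp
        (fun z => (φ z : ℂ))) g) 0 := by
      simpa using (hasDerivAt_const (0 : ℝ) ((memLp_testFunction hφ.continuous hc).toLp
        (fun z => (φ z : ℂ)))).inner ℂ hd
    have := h2.unique h1
    simp only [← pairing_eq_inner hφ.continuous hc, shift_zero] at this
    rw [← pairing, ← pairing, this, neg_neg]

/-! ### Difference quotients and the characterisation of `H^s`. -/

/-- The difference quotient `f ↦ (f(· + h) - f) / h` on `L²(ℝ)`. -/
noncomputable def diffQuot (h : ℝ) : L2C →L[ℂ] L2C :=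
  (h : ℂ)⁻¹ • ((shift h).toContinuousLinearMap - ContinuousLinearMap.id ℂ L2C)

theorem diffQuot_apply (h : ℝ) (f : L2C) : diffQuot h f = (h : ℂ)⁻¹ • (shift h f - f) := rfl

/-- Iterated difference quotients, with the steps taken from a list. -/
noncomputable def diffQuots : List ℝ → L2C →L[ℂ] L2C
  | [] => ContinuousLinearMap.id ℂ L2C
  | h :: l => (diffQuots l).comp (diffQuot h)

theorem diffQuots_cons (h : ℝ) (l : List ℝ) (f : L2C) :
    diffQuots (h :: l) f = diffQuots l (diffQuot h f) := rfl

theorem shift_diffQuot (a h : ℝ) (f : L2C) : shift a (diffQuot h f) = diffQuot h (shift a f) := by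
  simp only [diffQuot_apply, map_smul, map_sub, shift_shift, add_comm]

theorem shift_diffQuots (a : ℝ) (l : List ℝ) (f : L2C) :
    shift a (diffQuots l f) = diffQuots l (shift a f) := by
  induction l generalizing f with
  | nil => rfl
  | cons h l ih => rw [diffQuots_cons, diffQuots_cons, ih, shift_diffQuot]

theorem diffQuot_diffQuots (a : ℝ) (l : List ℝ) (f : L2C) :
    diffQuot a (diffQuots l f) = diffQuots l (diffQuot a f) := by
  simp only [diffQuot_apply, shift_diffQuots, map_smul, map_sub]

theorem HasWeakDeriv.map {f g : L2C} (hfg : HasWeakDeriv f g) (A : L2C →L[ℂ] L2C)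
    (hA : ∀ h f, shift h (A f) = A (shift h f)) : HasWeakDeriv (A f) (A g) := by
  rw [hasWeakDeriv_iff_hasDerivAt] at hfg ⊢
  simp only [hA]
  exact (A.restrictScalars ℝ).hasFDerivAt.comp_hasDerivAt (0 : ℝ) hfg

theorem HasWeakDeriv.diffQuots {f g : L2C} (hfg : HasWeakDeriv f g) (l : List ℝ) :
    HasWeakDeriv (diffQuots l f) (diffQuots l g) :=
  hfg.map _ fun h f => shift_diffQuots h l f

theorem HasWeakDeriv.norm_diffQuot_le {f g : L2C} (hfg : HasWeakDeriv f g) (h : ℝ) :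
    ‖diffQuot h f‖ ≤ ‖g‖ := by
  rw [diffQuot_apply, norm_smul, norm_inv, Complex.norm_real, Real.norm_eq_abs]
  -- Since `0⁻¹ = 0`, the quotient with step `0` is zero, so bounds can be stated for all steps.
  rcases eq_or_ne h 0 with rfl | hh
  · simp
  · rw [inv_mul_le_iff₀ (abs_pos.2 hh)]
    exact hfg.norm_shift_sub_le h

theorem HasWeakDeriv.tendsto_diffQuot {f g : L2C} (hfg : HasWeakDeriv f g) :
    Tendsto (fun h => diffQuot h f) (𝓝[≠] 0) (𝓝 g) := by
  have := hasDerivAt_iff_tendsto_slope.1 (hasWeakDeriv_iff_hasDerivAt.1 hfg)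
  refine this.congr fun h => ?_
  rw [slope_def_module, diffQuot_apply, shift_zero, sub_zero, ← Complex.ofReal_inv]
  exact (Complex.coe_smul _ _).symm

theorem HasWeakDeriv.norm_le {f g : L2C} (hfg : HasWeakDeriv f g) {C : ℝ}
    (hC : ∀ h, ‖diffQuot h f‖ ≤ C) : ‖g‖ ≤ C :=
  le_of_tendsto hfg.tendsto_diffQuot.norm (Eventually.of_forall hC)

/-- A function in `L²(ℝ)` with bounded difference quotients has a weak derivative. -/
theorem exists_hasWeakDeriv_of_norm_diffQuot_le {f : L2C} {C : ℝ}
    (hC : ∀ h, ‖diffQuot h f‖ ≤ C) : ∃ g, HasWeakDeriv f g := by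
  -- Banach–Alaoglu: along an ultrafilter of steps tending to 0 the bounded quotients converge
  -- weakly, and the limit is the weak derivative.
  let U : Ultrafilter ℝ := Ultrafilter.of (𝓝[≠] (0 : ℝ))
  let x : ℝ → WeakDual ℂ L2C := fun h =>
    StrongDual.toWeakDual (InnerProductSpace.toDual ℂ L2C (diffQuot h f))
  obtain ⟨y, -, hy⟩ := (WeakDual.isCompact_closedBall (𝕜 := ℂ) (E := L2C) 0 C).ultrafilter_le_nhds
    (U.map x) (by
      rw [le_principal_iff]
      refine mem_map.2 (Eventually.of_forall fun h => ?_)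
      simpa [x] using hC h)
  let g : L2C := (InnerProductSpace.toDual ℂ L2C).symm (WeakDual.toStrongDual y)
  have hg : ∀ ψ : L2C, Tendsto (fun h => inner ℂ (diffQuot h f) ψ) U (𝓝 (inner ℂ g ψ)) := by
    intro ψ
    have h1 : Tendsto x U (𝓝 y) := hy
    have h2 := ((WeakDual.eval_continuous ψ).tendsto y).comp h1
    convert! h2 using 2
    simp only [g, InnerProductSpace.toDual_symm_apply]
    rfl
  refine ⟨g, fun φ hφ hc => ?_⟩
  have h1 := hasDerivAt_iff_tendsto_slope.1 (hasDerivAt_pairing_shift hφ hc f 0)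
  have h2 := (hg ((memLp_testFunction hφ.continuous hc).toLp _)).star
  simp only [RCLike.star_def, inner_conj_symm, ← pairing_eq_inner hφ.continuous hc] at h2
  have h3 := tendsto_nhds_unique (h1.mono_left (Ultrafilter.of_le _)) (h2.congr fun h => ?_)
  · rw [shift_zero] at h3
    rw [← pairing, ← pairing, ← h3, neg_neg]
  · rw [slope_def_module, diffQuot_apply, shift_zero, sub_zero, pairing_eq_inner hφ.continuous hc,
      pairing_eq_inner hφ.continuous hc, pairing_eq_inner hφ.continuous hc, inner_smul_right,
      inner_sub_right, ← Complex.ofReal_inv]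
    exact (Complex.real_smul).symm

theorem MemHs.hasWeakDeriv {s : ℕ} {f : L2C} (hf : MemHs (s + 1) f) :
    HasWeakDeriv f (weakDeriv f) := by
  obtain ⟨g, hg, -⟩ := hf
  rwa [hg.weakDeriv_eq]

theorem MemHs.weakDeriv {s : ℕ} {f : L2C} (hf : MemHs (s + 1) f) : MemHs s (weakDeriv f) := by
  obtain ⟨g, hg, hg'⟩ := hf
  rwa [hg.weakDeriv_eq]

theorem MemHs.of_succ {s : ℕ} {f : L2C} (hf : MemHs (s + 1) f) : MemHs s f := by
  induction s generalizing f with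
  | zero => trivial
  | succ s ih => exact ⟨_, hf.hasWeakDeriv, ih hf.weakDeriv⟩

theorem MemHs.of_le {s r : ℕ} {f : L2C} (hf : MemHs s f) (h : r ≤ s) : MemHs r f := by
  induction h with
  | refl => exact hf
  | step _ ih => exact ih hf.of_succ

theorem MemHs.norm_diffQuots_le {l : List ℝ} {f : L2C} (hf : MemHs l.length f) :
    ‖diffQuots l f‖ ≤ ‖_root_.weakDeriv^[l.length] f‖ := by
  induction l generalizing f with
  | nil => exact le_rfl
  | cons h l ih =>
    rw [diffQuots_cons, ← diffQuot_diffQuots]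
    exact ((MemHs.hasWeakDeriv hf).diffQuots l |>.norm_diffQuot_le h).trans (ih hf.weakDeriv)

/-- A function in `L²(ℝ)` with bounded iterated difference quotients is in `H^s(ℝ)`. -/
theorem memHs_of_norm_diffQuots_le {s : ℕ} {f : L2C} {C : ℝ}
    (hC : ∀ l : List ℝ, l.length ≤ s → ‖diffQuots l f‖ ≤ C) :
    MemHs s f ∧ ∀ j ≤ s, ‖weakDeriv^[j] f‖ ≤ C := by
  induction s generalizing f with
  | zero => exact ⟨trivial, fun j hj => Nat.le_zero.1 hj ▸ hC [] (by simp)⟩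
  | succ s ih =>
    obtain ⟨g, hg⟩ := exists_hasWeakDeriv_of_norm_diffQuot_le (f := f) (C := C)
      fun h => hC [h] (by simp)
    -- Differences of `g` are limits of differences of `f` with one more step, so the constant `C`
    -- is inherited.
    have hb := ih (f := g) fun l hl => (hg.diffQuots l).norm_le fun h => by
      rw [diffQuot_diffQuots, ← diffQuots_cons]
      exact hC _ (by simpa using hl)
    refine ⟨⟨g, hg, hb.1⟩, fun j hj => ?_⟩
    cases j with
    | zero => exact hC [] (by simp)
    | succ j =>
      rw [Function.iterate_succ_apply, hg.weakDeriv_eq]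
      exact hb.2 j (by lia)

/-! ### The one-dimensional Sobolev inequality. -/

theorem memLp_comp_const_add (f : L2C) (z : ℝ) : MemLp (fun r => f (z + r)) 2 volume :=
  (Lp.memLp f).comp_measurePreserving (measurePreserving_add_left volume z)

theorem integrable_comp_const_add (f : L2C) (z : ℝ) :
    Integrable (fun r => f (z + r)) (volume.restrict (Ioc 0 1)) :=
  (memLp_comp_const_add f z |>.restrict _).integrable (by norm_num)

theorem integral_norm_comp_const_add_le (f : L2C) (z : ℝ) :
    ∫ r in Ioc (0 : ℝ) 1, ‖f (z + r)‖ ≤ ‖f‖ := by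
  have : IsProbabilityMeasure (volume.restrict (Ioc (0 : ℝ) 1)) := ⟨by simp⟩
  have hm := memLp_comp_const_add f z
  have h1 := eLpNorm_le_eLpNorm_of_exponent_le (μ := volume.restrict (Ioc (0 : ℝ) 1))
    (p := 1) (q := 2) (by norm_num) (hm.restrict (Ioc 0 1)).1
  rw [integral_norm_eq_lintegral_enorm (hm.restrict (Ioc 0 1)).1, ← eLpNorm_one_eq_lintegral_enorm,
    Lp.norm_def]
  refine ENNReal.toReal_mono (Lp.eLpNorm_ne_top f) (h1.trans ?_)
  refine (eLpNorm_mono_measure _ Measure.restrict_le_self).trans (le_of_eq ?_)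
  exact eLpNorm_comp_measurePreserving (Lp.aestronglyMeasurable f)
    (measurePreserving_add_left volume z)

theorem HasWeakDeriv.pairing_shift_sub {f g : L2C} (hfg : HasWeakDeriv f g) {φ : ℝ → ℝ}
    (hφ : ContDiff ℝ ∞ φ) (hc : HasCompactSupport φ) (h : ℝ) :
    pairing φ (shift h f) - pairing φ f = ∫ r in (0 : ℝ)..h, pairing φ (shift r g) := by
  rw [intervalIntegral.integral_eq_sub_of_hasDerivAt
    (fun r _ => hfg.hasDerivAt_pairing hφ hc r) (a := 0) (b := h), shift_zero]
  simp only [pairing_eq_inner hφ.continuous hc]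
  exact (continuous_const.inner (continuous_shift g)).intervalIntegrable _ _

/-- The integral formula for `pairing φ (shift h f)` becomes a pointwise one by Fubini, since test
functions separate locally integrable functions. -/
theorem HasWeakDeriv.shift_sub_ae_eq {f g : L2C} (hfg : HasWeakDeriv f g) {h : ℝ} (h0 : 0 ≤ h)
    (h1 : h ≤ 1) :
    ∀ᵐ z, f (z + h) - f z = ∫ r in Ioc 0 h, g (z + r) := by
  have hsub : Ioc 0 h ⊆ Ioc 0 1 := Ioc_subset_Ioc_right h1
  have hg2 : StronglyMeasurable (fun p : ℝ × ℝ => g (p.1 + p.2)) :=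
    (Lp.stronglyMeasurable g).comp_measurable (by fun_prop)
  have hbound : ∀ z, ∫ r in Ioc 0 h, ‖g (z + r)‖ ≤ ‖g‖ := fun z =>
    (setIntegral_mono_set (integrable_comp_const_add g z).norm (Eventually.of_forall fun _ =>
      norm_nonneg _) hsub.eventuallyLE).trans (integral_norm_comp_const_add_le g z)
  have hint : ∀ z, Integrable (fun r => g (z + r)) (volume.restrict (Ioc 0 h)) := fun z =>
    (integrable_comp_const_add g z).mono_measure (Measure.restrict_mono hsub le_rfl)
  have hloc : LocallyIntegrable (fun z => ∫ r in Ioc 0 h, g (z + r)) volume := by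
    refine (locallyIntegrable_const ‖g‖).mono hg2.integral_prod_right.aestronglyMeasurable ?_
    refine Eventually.of_forall fun z => ?_
    rw [norm_norm]
    exact (norm_integral_le_integral_norm _).trans (hbound z)
  have hae : ∀ᵐ z, (shift h f - f) z = ∫ r in Ioc 0 h, g (z + r) := by
    refine ae_eq_of_integral_contDiff_smul_eq ((Lp.memLp _).locallyIntegrable (by norm_num)) hloc ?_
    intro φ hφ hc
    have hprod : Integrable (Function.uncurry fun z r => φ z • g (z + r))
        (volume.prod (volume.restrict (Ioc 0 h))) := by
      have hm : StronglyMeasurable (Function.uncurry fun z r => φ z • g (z + r)) :=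
        (hφ.continuous.stronglyMeasurable.comp_measurable measurable_fst).smul hg2
      rw [integrable_prod_iff hm.aestronglyMeasurable]
      refine ⟨Eventually.of_forall fun z => (hint z).smul (φ z), ?_⟩
      refine ((hφ.continuous.integrable_of_hasCompactSupport hc).norm.mul_const ‖g‖).mono
        hm.norm.integral_prod_right.aestronglyMeasurable (Eventually.of_forall fun z => ?_)
      simp only [Function.uncurry, norm_smul, integral_const_mul, norm_mul, norm_norm]
      gcongr
      rw [Real.norm_of_nonneg (by positivity)]
      exact hbound z
    have hswap := integral_integral_swap hprod
    simp only [integral_smul] at hswap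
    rw [hswap, ← intervalIntegral.integral_of_le h0]
    have hp : ∀ r, ∫ z, φ z • g (z + r) = pairing φ (shift r g) := fun r => by
      apply integral_congr_ae
      filter_upwards [coeFn_shift r g] with z hz
      rw [hz]
    simp only [hp]
    rw [← hfg.pairing_shift_sub hφ hc, ← pairing, pairing_eq_inner hφ.continuous hc,
      pairing_eq_inner hφ.continuous hc, pairing_eq_inner hφ.continuous hc, inner_sub_right]
  filter_upwards [hae, Lp.coeFn_sub (shift h f) f, coeFn_shift h f] with z hz h2 h3
  rw [← hz, h2, Pi.sub_apply, h3]

/-- The one-dimensional Sobolev inequality `‖f‖_∞ ≤ ‖f‖ + ‖∂f‖`. -/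
theorem HasWeakDeriv.ae_norm_le {f g : L2C} (hfg : HasWeakDeriv f g) :
    ∀ᵐ z, ‖f z‖ ≤ ‖f‖ + ‖g‖ := by
  have : IsProbabilityMeasure (volume.restrict (Ioc (0 : ℝ) 1)) := ⟨by simp⟩
  have hm : StronglyMeasurable (f : ℝ → ℂ) := Lp.stronglyMeasurable f
  have h1 : ∀ᵐ r ∂volume.restrict (Ioc (0 : ℝ) 1), ∀ᵐ z, ‖f z‖ ≤ ‖f (z + r)‖ + ‖g‖ := by
    refine (ae_restrict_iff' measurableSet_Ioc).2 (Eventually.of_forall fun r hr => ?_)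
    filter_upwards [hfg.shift_sub_ae_eq hr.1.le hr.2] with z hz
    have h2 : ‖f (z + r) - f z‖ ≤ ‖g‖ := by
      rw [hz]
      refine (norm_integral_le_integral_norm _).trans (le_trans ?_
        (integral_norm_comp_const_add_le g z))
      exact setIntegral_mono_set (integrable_comp_const_add g z).norm (Eventually.of_forall fun _ =>
        norm_nonneg _) (Ioc_subset_Ioc_right hr.2).eventuallyLE
    have := norm_sub_norm_le (f z) (f (z + r))
    rw [norm_sub_rev] at this
    linarith
  -- The null set of `z` depends on `r`. Exchanging the quantifiers allows averaging over `r ∈ (0,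
  -- 1]` at a fixed `z`.
  rw [Measure.ae_ae_comm] at h1
  · filter_upwards [h1] with z hz
    have hf := integrable_comp_const_add f z
    calc ‖f z‖ = ∫ r in Ioc (0 : ℝ) 1, ‖f z‖ := by simp
      _ ≤ ∫ r in Ioc (0 : ℝ) 1, (‖f (z + r)‖ + ‖g‖) :=
        integral_mono_ae (integrable_const _) (hf.norm.add (integrable_const _)) hz
      _ = (∫ r in Ioc (0 : ℝ) 1, ‖f (z + r)‖) + ‖g‖ := by
        rw [integral_add hf.norm (integrable_const _)]
        simp
      _ ≤ ‖f‖ + ‖g‖ := by gcongr; exact integral_norm_comp_const_add_le f z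
  · refine measurableSet_le ?_ ?_
    · exact (hm.comp_measurable measurable_snd).norm.measurable
    · exact ((hm.comp_measurable (measurable_snd.add measurable_fst)).norm.add_const _).measurable

/-! ### Leibniz estimates for differences of triple products. -/

/-- The pointwise difference quotient of a function. -/
noncomputable def fdiff (h : ℝ) (f : ℝ → ℂ) : ℝ → ℂ := fun z => (h : ℂ)⁻¹ * (f (z + h) - f z)

/-- Iterated pointwise difference quotients, with the steps taken from a list. -/
noncomputable def fdiffs : List ℝ → (ℝ → ℂ) → ℝ → ℂ
  | [], f => f
  | h :: l, f => fdiffs l (fdiff h f)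

theorem fdiff_congr_ae {h : ℝ} {f g : ℝ → ℂ} (hfg : f =ᵐ[volume] g) :
    fdiff h f =ᵐ[volume] fdiff h g := by
  filter_upwards [hfg, ae_add_right hfg h] with z h1 h2
  rw [fdiff, fdiff, h1, h2]

theorem fdiffs_congr_ae {l : List ℝ} {f g : ℝ → ℂ} (hfg : f =ᵐ[volume] g) :
    fdiffs l f =ᵐ[volume] fdiffs l g := by
  induction l generalizing f g with
  | nil => exact hfg
  | cons h l ih => exact ih (fdiff_congr_ae hfg)

theorem coeFn_diffQuot (h : ℝ) (f : L2C) : diffQuot h f =ᵐ[volume] fdiff h f := by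
  rw [diffQuot_apply]
  filter_upwards [Lp.coeFn_smul (h : ℂ)⁻¹ (shift h f - f), Lp.coeFn_sub (shift h f) f,
    coeFn_shift h f] with z h1 h2 h3
  rw [h1, Pi.smul_apply, h2, Pi.sub_apply, h3, fdiff, smul_eq_mul]

theorem coeFn_diffQuots (l : List ℝ) (f : L2C) : diffQuots l f =ᵐ[volume] fdiffs l f := by
  induction l generalizing f with
  | nil => rfl
  | cons h l ih => exact (ih _).trans (fdiffs_congr_ae (coeFn_diffQuot h f))

theorem fdiffs_add (l : List ℝ) (f g : ℝ → ℂ) :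
    fdiffs l (fun z => f z + g z) = fun z => fdiffs l f z + fdiffs l g z := by
  induction l generalizing f g with
  | nil => rfl
  | cons h l ih =>
    simp only [fdiffs, ← ih]
    congr 1
    ext z
    simp only [fdiff]
    ring

theorem fdiffs_const_mul (l : List ℝ) (c : ℂ) (f : ℝ → ℂ) :
    fdiffs l (fun z => c * f z) = fun z => c * fdiffs l f z := by
  induction l generalizing f with
  | nil => rfl
  | cons h l ih =>
    simp only [fdiffs, ← ih]
    congr 1
    ext z
    simp only [fdiff]
    ring

theorem fdiff_conj (h : ℝ) (f : ℝ → ℂ) :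
    fdiff h (fun z => starRingEnd ℂ (f z)) = fun z => starRingEnd ℂ (fdiff h f z) := by
  ext z
  simp [fdiff]

theorem fdiffs_conj (l : List ℝ) (f : ℝ → ℂ) :
    fdiffs l (fun z => starRingEnd ℂ (f z)) = fun z => starRingEnd ℂ (fdiffs l f z) := by
  induction l generalizing f with
  | nil => rfl
  | cons h l ih => rw [fdiffs, fdiff_conj, ih, fdiffs]

theorem fdiffs_comp_add (l : List ℝ) (a : ℝ) (f : ℝ → ℂ) :
    fdiffs l (fun z => f (z + a)) = fun z => fdiffs l f (z + a) := by
  induction l generalizing f with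
  | nil => rfl
  | cons h l ih =>
    simp only [fdiffs, ← ih]
    congr 1
    ext z
    simp only [fdiff, add_right_comm]

theorem MeasureTheory.StronglyMeasurable.comp_add {f : ℝ → ℂ} (hf : StronglyMeasurable f) (a : ℝ) :
    StronglyMeasurable fun z => f (z + a) :=
  hf.comp_measurable (by fun_prop)

theorem MeasureTheory.StronglyMeasurable.fdiff {f : ℝ → ℂ} (hf : StronglyMeasurable f) (h : ℝ) :
    StronglyMeasurable (fdiff h f) :=
  ((hf.comp_add h).sub hf).const_mul _

theorem MeasureTheory.StronglyMeasurable.fdiffs {f : ℝ → ℂ} (hf : StronglyMeasurable f)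
    (l : List ℝ) : StronglyMeasurable (fdiffs l f) := by
  induction l generalizing f with
  | nil => exact hf
  | cons h l ih => exact ih (hf.fdiff h)

theorem eLpNorm_comp_add {f : ℝ → ℂ} (hf : StronglyMeasurable f) (a : ℝ) (p : ENNReal) :
    eLpNorm (fun z => f (z + a)) p volume = eLpNorm f p volume :=
  eLpNorm_comp_measurePreserving hf.aestronglyMeasurable (measurePreserving_add_right volume a)

theorem eLpNorm_fdiffs_comp_add {f : ℝ → ℂ} (hf : StronglyMeasurable f) (l : List ℝ) (a : ℝ)
    (p : ENNReal) : eLpNorm (fdiffs l fun z => f (z + a)) p volume = eLpNorm (fdiffs l f) p volume := by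
  rw [fdiffs_comp_add, eLpNorm_comp_add (hf.fdiffs l)]

/-- The discrete product rule leaves translates on some factors; these are harmless because all the
norms used are translation invariant. -/
theorem fdiff_mul_mul (h : ℝ) (f g k : ℝ → ℂ) :
    fdiff h (fun z => f z * g z * k z) = fun z =>
      (fdiff h f z * g (z + h) * k (z + h) + f z * fdiff h g z * k (z + h)) +
        f z * g z * fdiff h k z := by
  ext z
  simp only [fdiff]
  ring

theorem eLpNorm_mul_mul_le {f g k : ℝ → ℂ} (hg : StronglyMeasurable g)
    (hk : StronglyMeasurable k) :
    eLpNorm (fun z => f z * g z * k z) 2 volume ≤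
      eLpNorm f ⊤ volume * eLpNorm g ⊤ volume * eLpNorm k 2 volume := by
  have h1 := eLpNorm_smul_le_eLpNorm_top_mul_eLpNorm (μ := volume) 2
    (hg.mul hk).aestronglyMeasurable f
  have h2 := eLpNorm_smul_le_eLpNorm_top_mul_eLpNorm (μ := volume) 2 hk.aestronglyMeasurable g
  have : (fun z => f z * g z * k z) = f • (g * k) := by
    ext z
    simp [mul_assoc]
  rw [this, mul_assoc]
  exact h1.trans (by gcongr; exact h2)

theorem eLpNorm_add_add_le {a b c : ℝ → ℂ} {S : ENNReal} (ha : StronglyMeasurable a)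
    (hb : StronglyMeasurable b) (hc : StronglyMeasurable c) (hSa : eLpNorm a 2 volume ≤ S)
    (hSb : eLpNorm b 2 volume ≤ S) (hSc : eLpNorm c 2 volume ≤ S) :
    eLpNorm (fun z => a z + b z + c z) 2 volume ≤ 3 * S := by
  have h12 := eLpNorm_add_le (μ := volume) ha.aestronglyMeasurable hb.aestronglyMeasurable
    (one_le_two : (1 : ENNReal) ≤ 2)
  have h123 := eLpNorm_add_le (μ := volume) (ha.add hb).aestronglyMeasurable
    hc.aestronglyMeasurable (one_le_two : (1 : ENNReal) ≤ 2)
  calc _ ≤ S + S + S := h123.trans (add_le_add (h12.trans (add_le_add hSa hSb)) hSc)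
    _ = 3 * S := by ring

/-- The Leibniz rule for iterated differences of a triple product, as an estimate. -/
theorem eLpNorm_fdiffs_mul_mul_le (l : List ℝ) {f g k : ℝ → ℂ} (hf : StronglyMeasurable f)
    (hg : StronglyMeasurable g) (hk : StronglyMeasurable k) {R : ENNReal}
    (H : ∀ la lb lc : List ℝ, la.Sublist l → lb.Sublist l → lc.Sublist l →
      la.length + lb.length + lc.length = l.length →
      eLpNorm (fdiffs la f) ⊤ volume * eLpNorm (fdiffs lb g) ⊤ volume *
        eLpNorm (fdiffs lc k) 2 volume ≤ R) :
    eLpNorm (fdiffs l fun z => f z * g z * k z) 2 volume ≤ 3 ^ l.length * R := by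
  induction l generalizing f g k with
  | nil =>
    simp only [List.length_nil, pow_zero, one_mul]
    exact (eLpNorm_mul_mul_le hg hk).trans
      (H [] [] [] (List.Sublist.refl _) (List.Sublist.refl _) (List.Sublist.refl _) rfl)
  | cons h l ih =>
    have hf' := hf.fdiff h
    have hg' := hg.fdiff h
    have hk' := hk.fdiff h
    have h1 := ih hf' (hg.comp_add h) (hk.comp_add h) fun la lb lc ha hb hc hl => by
      rw [eLpNorm_fdiffs_comp_add hg, eLpNorm_fdiffs_comp_add hk]
      exact H (h :: la) lb lc (ha.cons_cons h) (hb.cons h) (hc.cons h)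
        (by simp only [List.length_cons]; lia)
    have h2 := ih hf hg' (hk.comp_add h) fun la lb lc ha hb hc hl => by
      rw [eLpNorm_fdiffs_comp_add hk]
      exact H la (h :: lb) lc (ha.cons h) (hb.cons_cons h) (hc.cons h)
        (by simp only [List.length_cons]; lia)
    have h3 := ih hf hg hk' fun la lb lc ha hb hc hl =>
      H la lb (h :: lc) (ha.cons h) (hb.cons h) (hc.cons_cons h)
        (by simp only [List.length_cons]; lia)
    rw [fdiffs, fdiff_mul_mul, fdiffs_add, fdiffs_add, List.length_cons, pow_succ', mul_assoc]
    exact eLpNorm_add_add_le (((hf'.mul (hg.comp_add h)).mul (hk.comp_add h)).fdiffs l)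
      (((hf.mul hg').mul (hk.comp_add h)).fdiffs l) (((hf.mul hg).mul hk').fdiffs l) h1 h2 h3

/-- Bounds for the iterated differences of a function along sublists of `l`: the supremum norms
are controlled by `A`, the `L²` norms after one more difference of step `h` by `B`. -/
structure DiffBounds (h : ℝ) (l : List ℝ) (A B : ℕ → ENNReal) (f : ℝ → ℂ) : Prop where
  meas : StronglyMeasurable f
  top : ∀ la : List ℝ, la.Sublist l → eLpNorm (fdiffs la f) ⊤ volume ≤ A la.length
  two : ∀ la : List ℝ, la.Sublist l → eLpNorm (fdiffs la (fdiff h f)) 2 volume ≤ B la.length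

theorem DiffBounds.conj {h : ℝ} {l : List ℝ} {A B : ℕ → ENNReal} {f : ℝ → ℂ}
    (hf : DiffBounds h l A B f) : DiffBounds h l A B fun z => starRingEnd ℂ (f z) where
  meas := Complex.continuous_conj.comp_stronglyMeasurable hf.meas
  top la ha := by
    rw [fdiffs_conj]
    exact (eLpNorm_congr_norm_ae (by simp)).trans_le (hf.top la ha)
  two la ha := by
    rw [fdiff_conj, fdiffs_conj]
    exact (eLpNorm_congr_norm_ae (by simp)).trans_le (hf.two la ha)

theorem DiffBounds.eLpNorm_mul_mul_le {h : ℝ} {l : List ℝ} {A B : ℕ → ENNReal} {f g k : ℝ → ℂ}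
    (hf : DiffBounds h l A B f) (hg : DiffBounds h l A B g) (hk : DiffBounds h l A B k)
    {R : ENNReal} (hR : ∀ a b c, a + b + c = l.length → A a * A b * B c ≤ R) :
    eLpNorm (fdiffs (h :: l) fun z => f z * g z * k z) 2 volume ≤ 3 ^ (l.length + 1) * R := by
  have hf' := hf.meas.fdiff h
  have hg' := hg.meas.fdiff h
  have hk' := hk.meas.fdiff h
  -- The factor hit by the difference of step `h` is moved to the last place, where the `L²` norm is
  -- taken; the remaining differences are then distributed.
  have h1 := eLpNorm_fdiffs_mul_mul_le l (hg.meas.comp_add h) (hk.meas.comp_add h) hf' (R := R)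
    fun la lb lc ha hb hc hl => by
      rw [eLpNorm_fdiffs_comp_add hg.meas, eLpNorm_fdiffs_comp_add hk.meas]
      exact (mul_le_mul' (mul_le_mul' (hg.top la ha) (hk.top lb hb)) (hf.two lc hc)).trans
        (hR _ _ _ hl)
  have h2 := eLpNorm_fdiffs_mul_mul_le l hf.meas (hk.meas.comp_add h) hg' (R := R)
    fun la lb lc ha hb hc hl => by
      rw [eLpNorm_fdiffs_comp_add hk.meas]
      exact (mul_le_mul' (mul_le_mul' (hf.top la ha) (hk.top lb hb)) (hg.two lc hc)).trans
        (hR _ _ _ hl)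
  have h3 := eLpNorm_fdiffs_mul_mul_le l hf.meas hg.meas hk' (R := R) fun la lb lc ha hb hc hl =>
      (mul_le_mul' (mul_le_mul' (hf.top la ha) (hg.top lb hb)) (hk.two lc hc)).trans (hR _ _ _ hl)
  have key : (fdiffs (h :: l) fun z => f z * g z * k z) = fun z =>
      (fdiffs l (fun z => g (z + h) * k (z + h) * fdiff h f z) z +
        fdiffs l (fun z => f z * k (z + h) * fdiff h g z) z) +
        fdiffs l (fun z => f z * g z * fdiff h k z) z := by
    rw [fdiffs, fdiff_mul_mul, fdiffs_add, fdiffs_add]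
    simp only [mul_comm, mul_left_comm]
  rw [key, pow_succ', mul_assoc]
  exact eLpNorm_add_add_le (((hg.meas.comp_add h).mul (hk.meas.comp_add h) |>.mul hf').fdiffs l)
    ((hf.meas.mul (hk.meas.comp_add h) |>.mul hg').fdiffs l)
    ((hf.meas.mul hg.meas |>.mul hk').fdiffs l) h1 h2 h3

/-! ### Distance to the functions bounded by `m`. -/

/-- The difference of `w` and its projection to the disc of radius `m`. -/
noncomputable def excess (m : ℝ) (w : ℂ) : ℂ := ((max 0 (1 - m / ‖w‖) : ℝ) : ℂ) * w

theorem measurable_excess (m : ℝ) : Measurable (excess m) := by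
  unfold excess
  fun_prop

theorem max_zero_one_sub_div_mul (m x : ℝ) (hm : 0 ≤ m) (hx : 0 ≤ x) :
    max 0 (1 - m / x) * x = max 0 (x - m) := by
  rcases hx.eq_or_lt with rfl | h
  · simp [hm]
  · rw [max_mul_of_nonneg _ _ hx, zero_mul]
    congr 1
    field_simp

theorem norm_excess {m : ℝ} (hm : 0 ≤ m) (w : ℂ) : ‖excess m w‖ = max 0 (‖w‖ - m) := by
  rw [excess, norm_mul, Complex.norm_real, Real.norm_of_nonneg (le_max_left _ _),
    max_zero_one_sub_div_mul m _ hm (norm_nonneg w)]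

theorem norm_excess_le {m : ℝ} (hm : 0 ≤ m) (w : ℂ) : ‖excess m w‖ ≤ ‖w‖ := by
  rw [norm_excess hm]
  exact max_le (norm_nonneg w) (by linarith)

theorem excess_zero (w : ℂ) : excess 0 w = w := by simp [excess]

theorem norm_sub_excess_le {m : ℝ} (hm : 0 ≤ m) (w : ℂ) : ‖w - excess m w‖ ≤ m := by
  have h1 : w - excess m w = ((1 - max 0 (1 - m / ‖w‖) : ℝ) : ℂ) * w := by
    rw [excess]
    push_cast
    ring
  have h2 : 0 ≤ 1 - max 0 (1 - m / ‖w‖) := by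
    rw [sub_nonneg]
    refine max_le zero_le_one ?_
    have : 0 ≤ m / ‖w‖ := by positivity
    linarith
  rw [h1, norm_mul, Complex.norm_real, Real.norm_of_nonneg h2, sub_mul,
    max_zero_one_sub_div_mul m _ hm (norm_nonneg w)]
  have := le_max_right 0 (‖w‖ - m)
  linarith

theorem norm_excess_le_norm_sub {m : ℝ} (hm : 0 ≤ m) (w : ℂ) {p : ℂ} (hp : ‖p‖ ≤ m) :
    ‖excess m w‖ ≤ ‖w - p‖ := by
  rw [norm_excess hm]
  refine max_le (norm_nonneg _) ?_
  have := norm_sub_norm_le w p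
  linarith

theorem memLp_excess {m : ℝ} (hm : 0 ≤ m) (f : L2C) :
    MemLp (fun z => excess m (f z)) 2 volume :=
  (Lp.memLp f).of_le ((measurable_excess m).comp_aemeasurable
    (Lp.aestronglyMeasurable f).aemeasurable).aestronglyMeasurable
    (Eventually.of_forall fun _ => norm_excess_le hm _)

/-- The difference of `f ∈ L²(ℝ)` and its projection to the functions bounded by `m`. -/
noncomputable def l2Excess {m : ℝ} (hm : 0 ≤ m) (f : L2C) : L2C := (memLp_excess hm f).toLp _

theorem coeFn_l2Excess {m : ℝ} (hm : 0 ≤ m) (f : L2C) :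
    l2Excess hm f =ᵐ[volume] fun z => excess m (f z) := (memLp_excess hm f).coeFn_toLp

/-- `f₀ - l2Excess hm f₀` is bounded by `m`, so it competes in the distance from `f`. The right side
is smooth in `f` and equals the left at `f = f₀`, which avoids differentiating the truncation. -/
theorem norm_l2Excess_le {m : ℝ} (hm : 0 ≤ m) (f f₀ : L2C) :
    ‖l2Excess hm f‖ ≤ ‖f - f₀ + l2Excess hm f₀‖ := by
  apply Lp.norm_le_norm_of_ae_le
  filter_upwards [coeFn_l2Excess hm f, coeFn_l2Excess hm f₀, Lp.coeFn_sub f f₀,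
    Lp.coeFn_add (f - f₀) (l2Excess hm f₀)] with z h1 h2 h3 h4
  rw [h1, h4, Pi.add_apply, h3, h2, Pi.sub_apply, ← add_sub_right_comm, ← sub_sub_eq_add_sub]
  exact norm_excess_le_norm_sub hm _ (norm_sub_excess_le hm _)

theorem l2Excess_zero (f : L2C) : l2Excess le_rfl f = f := by
  apply Lp.ext
  filter_upwards [coeFn_l2Excess le_rfl f] with z h1
  rw [h1, excess_zero]

theorem shift_l2Excess {m : ℝ} (hm : 0 ≤ m) (h : ℝ) (f : L2C) :
    shift h (l2Excess hm f) = l2Excess hm (shift h f) := by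
  apply Lp.ext
  filter_upwards [coeFn_l2Excess hm (shift h f), coeFn_shift h (l2Excess hm f), coeFn_shift h f,
    ae_add_right (coeFn_l2Excess hm f) h] with z h1 h2 h3 h4
  rw [h1, h2, h3, h4]

theorem continuous_norm_l2Excess {m : ℝ} (hm : 0 ≤ m) : Continuous fun f => ‖l2Excess hm f‖ := by
  refine (LipschitzWith.of_le_add fun f g => ?_).continuous
  rw [dist_eq_norm]
  have := (norm_l2Excess_le hm f g).trans (norm_add_le _ _)
  linarith

theorem l2Excess_eq_zero {m : ℝ} (hm : 0 ≤ m) {f : L2C} :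
    l2Excess hm f = 0 ↔ ∀ᵐ z, ‖f z‖ ≤ m := by
  rw [Lp.eq_zero_iff_ae_eq_zero]
  refine eventually_congr ?_
  filter_upwards [coeFn_l2Excess hm f] with z hz
  rw [hz, Pi.zero_apply, ← norm_eq_zero, norm_excess hm, max_eq_left_iff, sub_nonpos]

/-- Translation preserves the distance to the functions bounded by `m`, so the smooth majorant of
the distance of `shift h f` is minimal at `h = 0`; its derivative there is twice this inner product.
This removes the transport term. -/
theorem HasWeakDeriv.inner_l2Excess {m : ℝ} (hm : 0 ≤ m) {f g : L2C} (hfg : HasWeakDeriv f g) :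
    inner ℝ (l2Excess hm f) g = 0 := by
  have h1 : HasDerivAt (fun h => ‖shift h f - f + l2Excess hm f‖ ^ 2)
      (2 * inner ℝ (l2Excess hm f) g) 0 := by
    have := (((hasWeakDeriv_iff_hasDerivAt.1 hfg).sub_const f).add_const (l2Excess hm f)).norm_sq
    simpa [shift_zero] using this
  have h2 : IsLocalMin (fun h => ‖shift h f - f + l2Excess hm f‖ ^ 2) 0 := by
    refine Eventually.of_forall fun h => ?_
    have h3 := norm_l2Excess_le hm (shift h f) f
    rw [← shift_l2Excess, LinearIsometry.norm_map] at h3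
    simp only [shift_zero, sub_self, zero_add]
    gcongr
  linarith [h2.hasDerivAt_eq_zero h1]

theorem HasWeakDeriv.inner_self {f g : L2C} (hfg : HasWeakDeriv f g) : inner ℝ f g = 0 := by
  simpa only [l2Excess_zero] using hfg.inner_l2Excess le_rfl

/-- `excess m a` is a nonnegative real multiple of `a`, hence orthogonal to `i n a` for real `n`:
the nonlinearity drops out. -/
theorem inner_excess_le {m κ n : ℝ} (hm : 0 ≤ m) (a b : ℂ) :
    inner ℝ (excess m a) (Complex.I * (κ * b + n * a) - |κ| • a) ≤
      |κ| * (max 0 (‖a‖ - m) * (‖b‖ - ‖a‖)) := by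
  have h1 : inner ℝ (excess m a) (Complex.I * (κ * b + n * a) - |κ| • a) =
      max 0 (1 - m / ‖a‖) * (inner ℝ a (κ • (Complex.I * b)) - |κ| * ‖a‖ ^ 2) := by
    have : excess m a = (max 0 (1 - m / ‖a‖)) • a := by
      rw [excess, Complex.real_smul]
    rw [this, real_inner_smul_left, inner_sub_right, real_inner_smul_right _ a,
      real_inner_self_eq_norm_sq]
    congr 2
    simp only [Complex.inner, Complex.mul_re, Complex.mul_im, Complex.add_re, Complex.add_im,
      Complex.conj_re, Complex.conj_im, Complex.ofReal_re, Complex.ofReal_im, Complex.I_re,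
      Complex.I_im, Complex.real_smul]
    ring
  have h2 : inner ℝ a (κ • (Complex.I * b)) ≤ |κ| * (‖a‖ * ‖b‖) := by
    refine (real_inner_le_norm _ _).trans (le_of_eq ?_)
    rw [norm_smul, norm_mul, Complex.norm_I, Real.norm_eq_abs]
    ring
  rw [h1, ← max_zero_one_sub_div_mul m _ hm (norm_nonneg a)]
  calc _ ≤ max 0 (1 - m / ‖a‖) * (|κ| * (‖a‖ * ‖b‖) - |κ| * ‖a‖ ^ 2) := by
        gcongr
    _ = _ := by ring

theorem inner_l2Excess_add_le {m κ : ℝ} (hm : 0 ≤ m) {f g F G : L2C} {n₁ n₂ : ℝ → ℝ}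
    (hF : ∀ᵐ z, F z = Complex.I * (κ * g z + n₁ z * f z))
    (hG : ∀ᵐ z, G z = Complex.I * (κ * f z + n₂ z * g z)) :
    inner ℝ (l2Excess hm f) (F - |κ| • f) + inner ℝ (l2Excess hm g) (G - |κ| • g) ≤ 0 := by
  rw [L2.inner_def, L2.inner_def, ← integral_add (L2.integrable_inner _ _)
    (L2.integrable_inner _ _)]
  apply integral_nonpos_of_ae
  filter_upwards [hF, hG, coeFn_l2Excess hm f, coeFn_l2Excess hm g, Lp.coeFn_sub F (|κ| • f),
    Lp.coeFn_sub G (|κ| • g), Lp.coeFn_smul |κ| f, Lp.coeFn_smul |κ| g]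
    with z hF hG h1 h2 h3 h4 h5 h6
  rw [h1, h2, h3, h4, Pi.sub_apply, Pi.sub_apply, h5, h6, hF, hG]
  have e1 := inner_excess_le (κ := κ) (n := n₁ z) hm (f z) (g z)
  have e2 := inner_excess_le (κ := κ) (n := n₂ z) hm (g z) (f z)
  -- `r ↦ max 0 (r - m)` is monotone, so the two gains and losses from the coupling have a
  -- nonpositive sum.
  have e3 : max 0 (‖f z‖ - m) * (‖g z‖ - ‖f z‖) + max 0 (‖g z‖ - m) * (‖f z‖ - ‖g z‖) ≤ 0 := by
    rcases le_total ‖f z‖ ‖g z‖ with h | h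
    · have : max 0 (‖f z‖ - m) ≤ max 0 (‖g z‖ - m) := by gcongr
      nlinarith
    · have : max 0 (‖g z‖ - m) ≤ max 0 (‖f z‖ - m) := by gcongr
      nlinarith
  have e4 := mul_nonpos_of_nonneg_of_nonpos (abs_nonneg κ) e3
  simp only [Pi.smul_apply, Pi.zero_apply]
  linarith

/-! ### Bounds of the solution in `L²` and `L^∞`. -/

namespace IsNLCMESolutionOn

variable {v κ Γ : ℝ} {I : Set ℝ} {Ep Em : ℝ → L2C}

/-- Lets every estimate be proved for one component only. -/
theorem swap (h : IsNLCMESolutionOn v κ Γ I Ep Em) : IsNLCMESolutionOn (-v) κ Γ I Em Ep where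
  memH1_p := h.memH1_m
  memH1_m := h.memH1_p
  continuousOn_p := h.continuousOn_m
  continuousOn_m := h.continuousOn_p
  continuousOn_deriv_p := h.continuousOn_deriv_m
  continuousOn_deriv_m := h.continuousOn_deriv_p
  eq_p := by simpa [sub_eq_add_neg] using h.eq_m
  eq_m := by simpa using h.eq_p

theorem exists_hasDerivWithinAt (h : IsNLCMESolutionOn v κ Γ I Ep Em) {t : ℝ} (ht : t ∈ I) :
    ∃ F : L2C, HasDerivWithinAt Ep (F - v • weakDeriv (Ep t)) I t ∧
      ∀ᵐ z, F z = Complex.I * (κ * Em t z +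
        (Γ * (‖Ep t z‖ ^ 2 + 2 * ‖Em t z‖ ^ 2) : ℝ) * Ep t z) := by
  obtain ⟨D, hD, he⟩ := h.eq_p t ht
  refine ⟨D + v • weakDeriv (Ep t), by simpa using hD, ?_⟩
  filter_upwards [he, Lp.coeFn_add D (v • weakDeriv (Ep t)),
    Lp.coeFn_smul v (weakDeriv (Ep t))] with z h1 h2 h3
  rw [h2, Pi.add_apply, h3, Pi.smul_apply, Complex.real_smul]
  have h4 := congrArg (fun x => -Complex.I * x) h1
  simp only [mul_zero] at h4
  push_cast at h4 ⊢
  linear_combination h4 + (D z + v * weakDeriv (Ep t) z) * Complex.I_sq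

theorem hasWeakDeriv (h : IsNLCMESolutionOn v κ Γ I Ep Em) {t : ℝ} (ht : t ∈ I) :
    HasWeakDeriv (Ep t) (weakDeriv (Ep t)) := (h.memH1_p t ht).hasWeakDeriv

end IsNLCMESolutionOn

/-- A continuous function that is touched from above, at each time, by a function with
non-positive right derivative, does not exceed its initial value. -/
theorem le_initial_of_touching {Φ : ℝ → ℝ} {T : ℝ} (hΦ : ContinuousOn Φ (Icc 0 T))
    (H : ∀ t ∈ Ico 0 T, ∃ U : ℝ → ℝ, ∃ U' : ℝ, (∀ r, Φ r ≤ U r) ∧ U t = Φ t ∧ U' ≤ 0 ∧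
      HasDerivWithinAt U U' (Ici t) t) : ∀ t ∈ Icc 0 T, Φ t ≤ Φ 0 := by
  refine image_le_of_liminf_slope_right_le_deriv_boundary (B := fun _ => Φ 0) (B' := fun _ => 0)
    hΦ le_rfl continuousOn_const (fun x _ => hasDerivWithinAt_const _ _ _) ?_
  intro t ht r hr
  obtain ⟨U, U', hU, hUt, hU', hd⟩ := H t ht
  refine ((hd.liminf_right_slope_le (hU'.trans_lt hr)).and_eventually self_mem_nhdsWithin).mono ?_
  rintro z ⟨hz, hzt⟩
  refine lt_of_le_of_lt ?_ hz
  rw [slope_def_field, slope_def_field, hUt]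
  have : 0 < z - t := sub_pos.2 hzt
  gcongr
  exact hU z

theorem HasWeakDeriv.real_smul {f g : L2C} (hfg : HasWeakDeriv f g) (c : ℝ) :
    HasWeakDeriv (c • f) (c • g) := by
  rw [hasWeakDeriv_iff_hasDerivAt] at hfg ⊢
  have h : ∀ h, shift h (c • f) = c • shift h f := fun h =>
    ((shift h).toContinuousLinearMap.restrictScalars ℝ).map_smul c f
  simp only [h]
  exact hfg.const_smul c

namespace IsNLCMESolutionOn

variable {v κ Γ T : ℝ} {Ep Em : ℝ → L2C}

theorem hasDerivWithinAt_damped {c t : ℝ} {f : ℝ → L2C} {D : L2C} {s : Set ℝ}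
    (hf : HasDerivWithinAt f D s t) :
    HasDerivWithinAt (fun r => Real.exp (-c * r) • f r)
      (Real.exp (-c * t) • D - c • (Real.exp (-c * t) • f t)) s t := by
  have h1 : HasDerivAt (fun r => Real.exp (-c * r)) (Real.exp (-c * t) * (-c * 1)) t :=
    ((hasDerivAt_id t).const_mul (-c)).exp
  convert! h1.hasDerivWithinAt.smul hf using 1
  rw [mul_one, mul_neg, neg_smul, ← sub_eq_add_neg, smul_smul, mul_comm c]

/-- Only the reality of the nonlinear multiplier `n` is retained; its size plays no part in the
distance estimate. -/
theorem exists_damped (h : IsNLCMESolutionOn v κ Γ (Icc 0 T) Ep Em) {t : ℝ} (ht : t ∈ Ico 0 T) :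
    ∃ (F : L2C) (n : ℝ → ℝ),
      HasDerivWithinAt (fun r => Real.exp (-|κ| * r) • Ep r)
        (F - |κ| • (Real.exp (-|κ| * t) • Ep t) -
          v • (Real.exp (-|κ| * t) • weakDeriv (Ep t))) (Ici t) t ∧
      ∀ᵐ z, F z = Complex.I * (κ * (Real.exp (-|κ| * t) • Em t : L2C) z +
        n z * (Real.exp (-|κ| * t) • Ep t : L2C) z) := by
  obtain ⟨F, hF, he⟩ := h.exists_hasDerivWithinAt (Ico_subset_Icc_self ht)
  refine ⟨Real.exp (-|κ| * t) • F, fun z => Γ * (‖Ep t z‖ ^ 2 + 2 * ‖Em t z‖ ^ 2), ?_, ?_⟩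
  · convert! hasDerivWithinAt_damped (hF.mono_of_mem_nhdsWithin (Icc_mem_nhdsGE_of_mem ht)) using 1
    rw [smul_sub, smul_comm v]
    abel
  · filter_upwards [he, Lp.coeFn_smul (Real.exp (-|κ| * t)) F,
      Lp.coeFn_smul (Real.exp (-|κ| * t)) (Ep t),
      Lp.coeFn_smul (Real.exp (-|κ| * t)) (Em t)] with z h1 h2 h3 h4
    rw [h2, h3, h4, Pi.smul_apply, Pi.smul_apply, Pi.smul_apply, h1]
    simp only [Complex.real_smul]
    ring

/-- The distance of the damped solution to the pairs of functions bounded by `m` does not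
increase. -/
theorem sq_norm_l2Excess_le (h : IsNLCMESolutionOn v κ Γ (Icc 0 T) Ep Em) {m : ℝ} (hm : 0 ≤ m)
    {t : ℝ} (ht : t ∈ Icc 0 T) :
    ‖l2Excess hm (Real.exp (-|κ| * t) • Ep t)‖ ^ 2 +
        ‖l2Excess hm (Real.exp (-|κ| * t) • Em t)‖ ^ 2 ≤
      ‖l2Excess hm (Ep 0)‖ ^ 2 + ‖l2Excess hm (Em 0)‖ ^ 2 := by
  have hexp : Continuous fun r => Real.exp (-|κ| * r) := by fun_prop
  have hc : ∀ E : ℝ → L2C, ContinuousOn E (Icc 0 T) → ContinuousOn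
      (fun r => ‖l2Excess hm (Real.exp (-|κ| * r) • E r)‖ ^ 2) (Icc 0 T) := fun E hE =>
    ((continuous_norm_l2Excess hm).comp_continuousOn (hexp.continuousOn.smul hE)).pow 2
  have key := le_initial_of_touching ((hc _ h.continuousOn_p).add (hc _ h.continuousOn_m)) ?_ t ht
  · simpa using key
  clear ht t
  intro t ht
  obtain ⟨F, n₁, hF, hFe⟩ := h.exists_damped ht
  obtain ⟨G, n₂, hG, hGe⟩ := h.swap.exists_damped ht
  set f := Real.exp (-|κ| * t) • Ep t with hf
  set g := Real.exp (-|κ| * t) • Em t with hg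
  have d1 := ((hF.sub_const f).add_const (l2Excess hm f)).norm_sq
  have d2 := ((hG.sub_const g).add_const (l2Excess hm g)).norm_sq
  refine ⟨_, _, fun r => ?_, ?_, ?_, d1.add d2⟩
  · simp only [Pi.add_apply]
    gcongr <;> exact norm_l2Excess_le hm _ _
  · simp only [Pi.add_apply, ← hf, ← hg, sub_self, zero_add]
  · have e1 := inner_l2Excess_add_le hm hFe hGe
    have e2 := ((h.hasWeakDeriv (Ico_subset_Icc_self ht)).real_smul
      (Real.exp (-|κ| * t))).inner_l2Excess hm
    have e3 := ((h.swap.hasWeakDeriv (Ico_subset_Icc_self ht)).real_smul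
      (Real.exp (-|κ| * t))).inner_l2Excess hm
    simp only [← hf, ← hg, sub_self, zero_add] at e2 e3 ⊢
    rw [inner_sub_right, inner_sub_right _ (G - _), real_inner_smul_right _ _ v,
      real_inner_smul_right _ _ (-v), e2, e3]
    linarith

/-- The solution stays bounded in `L^∞` and in `L²`. -/
theorem bounds (h : IsNLCMESolutionOn v κ Γ (Icc 0 T) Ep Em) {x : ℝ}
    (hx : ‖Ep 0‖ + ‖weakDeriv (Ep 0)‖ + ‖Em 0‖ + ‖weakDeriv (Em 0)‖ ≤ x) {t : ℝ}
    (ht : t ∈ Icc 0 T) :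
    ‖Ep t‖ ≤ Real.exp (|κ| * T) * x ∧ ∀ᵐ z, ‖Ep t z‖ ≤ Real.exp (|κ| * T) * x := by
  have h0 : (0 : ℝ) ∈ Icc 0 T := ⟨le_rfl, ht.1.trans ht.2⟩
  have n1 := norm_nonneg (Ep 0)
  have n2 := norm_nonneg (Em 0)
  have n3 := norm_nonneg (weakDeriv (Ep 0))
  have n4 := norm_nonneg (weakDeriv (Em 0))
  have hx0 : 0 ≤ x := by linarith
  have hexp : ∀ y, Real.exp (-|κ| * t) * y ≤ x → y ≤ Real.exp (|κ| * T) * x := by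
    intro y hy
    have : y = Real.exp (|κ| * t) * (Real.exp (-|κ| * t) * y) := by
      rw [← mul_assoc, ← Real.exp_add]
      simp
    rw [this]
    calc _ ≤ Real.exp (|κ| * t) * x := by gcongr
      _ ≤ _ := by
        gcongr
        exact ht.2
  constructor
  · apply hexp
    -- For `m = 0` the excess is the function itself.
    have := h.sq_norm_l2Excess_le le_rfl ht
    simp only [l2Excess_zero, norm_smul, Real.norm_eq_abs, Real.abs_exp] at this
    have e : 0 ≤ Real.exp (-|κ| * t) * ‖Em t‖ := by positivity
    refine (pow_le_pow_iff_left₀ (by positivity) hx0 two_ne_zero).1 ?_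
    nlinarith
  -- For `m = x` the initial excess vanishes by the Sobolev inequality, hence so does the excess at
  -- time `t`.
  · have := h.sq_norm_l2Excess_le hx0 ht
    rw [(l2Excess_eq_zero hx0 (f := Ep 0)).2, (l2Excess_eq_zero hx0 (f := Em 0)).2] at this
    · have h1 : l2Excess hx0 (Real.exp (-|κ| * t) • Ep t) = 0 := by
        rw [← norm_eq_zero]
        simp only [norm_zero] at this
        nlinarith [sq_nonneg ‖l2Excess hx0 (Real.exp (-|κ| * t) • Em t)‖]
      rw [l2Excess_eq_zero] at h1
      filter_upwards [h1, Lp.coeFn_smul (Real.exp (-|κ| * t)) (Ep t)] with z h2 h3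
      apply hexp
      rwa [h3, Pi.smul_apply, norm_smul, Real.norm_eq_abs, Real.abs_exp] at h2
    · filter_upwards [(h.swap.hasWeakDeriv h0).ae_norm_le] with z hz
      linarith
    · filter_upwards [(h.hasWeakDeriv h0).ae_norm_le] with z hz
      linarith

end IsNLCMESolutionOn

/-! ### Estimate of the coupling and nonlinear terms. -/

theorem eLpNorm_fdiffs (l : List ℝ) (f : L2C) :
    eLpNorm (fdiffs l f) 2 volume = ENNReal.ofReal ‖diffQuots l f‖ := by
  rw [ofReal_norm, Lp.enorm_def]
  exact (eLpNorm_congr_ae (coeFn_diffQuots l f)).symm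

/-- Bounds by `M` for `f`: for its iterated differences of order at most `k` and those of its
weak derivative of order less than `k` in `L²`, and for `f` itself in `L^∞`. -/
structure StageBound (k : ℕ) (M : ℝ) (f : L2C) : Prop where
  diff : ∀ l : List ℝ, l.length ≤ k → ‖diffQuots l f‖ ≤ M
  diff_deriv : ∀ l : List ℝ, l.length < k → ‖diffQuots l (weakDeriv f)‖ ≤ M
  top : ∀ᵐ z, ‖f z‖ ≤ M

theorem StageBound.nonneg {k : ℕ} {M : ℝ} {f : L2C} (hf : StageBound k M f) : 0 ≤ M :=
  (norm_nonneg _).trans (hf.diff [] (by simp))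

/-- The bound for the supremum norm of an `n`-th difference, when `k` is the top order. -/
noncomputable def topBound (k : ℕ) (M y : ℝ) (n : ℕ) : ℝ :=
  if n = 0 then M else if n < k then 2 * M else M + y

/-- The bound for the `L²` norm of an `n`-th difference, when `k` is the top order. -/
noncomputable def twoBound (k : ℕ) (M y : ℝ) (n : ℕ) : ℝ := if n < k then M else y

theorem topBound_nonneg {k : ℕ} {M y : ℝ} (hM : 0 ≤ M) (hy : 0 ≤ y) (n : ℕ) :
    0 ≤ topBound k M y n := by
  unfold topBound
  split_ifs <;> positivity

/-- If `k > 0`, at most one of `a`, `b`, `c` equals `k`, and the other two are then 0; if `k = 0`,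
only the `L²` factor involves `y`. So no product is quadratic in `y`, and the worst lower-order one
is `2M · 2M · M`. -/
theorem topBound_mul_le {k : ℕ} {M y : ℝ} (hM : 0 ≤ M) (hy : 0 ≤ y) {a b c : ℕ}
    (h : a + b + c = k) :
    topBound k M y a * topBound k M y b * twoBound k M y c ≤ 4 * M ^ 2 * (M + y) := by
  have e1 : 0 ≤ M ^ 3 := by positivity
  have e2 : 0 ≤ M ^ 2 * y := by positivity
  unfold topBound twoBound
  split_ifs <;> first | (exfalso; lia) | nlinarith

theorem StageBound.diffBounds {k : ℕ} {M y : ℝ} {f : L2C} (hf : StageBound k M f)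
    (hw : HasWeakDeriv f (weakDeriv f)) {l : List ℝ} (hl : l.length = k)
    (hy : ‖diffQuots l (weakDeriv f)‖ ≤ y) (h : ℝ) :
    DiffBounds h l (fun n => ENNReal.ofReal (topBound k M y n))
      (fun n => ENNReal.ofReal (twoBound k M y n)) f where
  meas := Lp.stronglyMeasurable f
  top la ha := by
    rw [eLpNorm_exponent_top]
    refine eLpNormEssSup_le_of_ae_bound ?_
    filter_upwards [hf.top, coeFn_diffQuots la f, (hw.diffQuots la).ae_norm_le] with z h1 h2 h3
    have hla := ha.length_le
    unfold topBound
    split_ifs with h4 h5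
    -- Order 0 uses the `L^∞` bound and not the Sobolev inequality: for `k = 0` the latter would
    -- bring in `y`.
    · rw [List.length_eq_zero_iff.1 h4]
      exact h1
    · rw [← h2]
      linarith [hf.diff la (by lia), hf.diff_deriv la h5]
    · rw [← h2]
      have := ha.eq_of_length (by lia)
      subst this
      linarith [hf.diff la hl.le]
  two la ha := by
    have hla := ha.length_le
    have : eLpNorm (fdiffs la (fdiff h f)) 2 volume =
      ENNReal.ofReal ‖diffQuots (h :: la) f‖ := (eLpNorm_fdiffs (h :: la) f)
    rw [this, diffQuots_cons, ← diffQuot_diffQuots]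
    refine ENNReal.ofReal_le_ofReal (((hw.diffQuots la).norm_diffQuot_le h).trans ?_)
    unfold twoBound
    split_ifs with h5
    · exact hf.diff_deriv la h5
    -- A sublist of full length is `l` itself, the only list of top order for which `y` is a bound.
    · have := ha.eq_of_length (by lia)
      subst this
      exact hy

/-- The constant in the estimate of the nonlinear terms. -/
noncomputable def nonlinConst (Γ : ℝ) (k : ℕ) : ℝ := 3 * |Γ| * 3 ^ (k + 1) * 4

/-- The estimate of the coupling and nonlinear terms of the equations. -/
theorem norm_diffQuots_nonlin_le {κ Γ M y : ℝ} {k : ℕ} {f g F : L2C} (hf : StageBound k M f)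
    (hg : StageBound k M g) (hwf : HasWeakDeriv f (weakDeriv f))
    (hwg : HasWeakDeriv g (weakDeriv g)) {l : List ℝ} (hl : l.length = k)
    (hyf : ‖diffQuots l (weakDeriv f)‖ ≤ y) (hyg : ‖diffQuots l (weakDeriv g)‖ ≤ y)
    (hF : ∀ᵐ z, F z = Complex.I * (κ * g z + (Γ * (‖f z‖ ^ 2 + 2 * ‖g z‖ ^ 2) : ℝ) * f z))
    (h : ℝ) :
    ‖diffQuots (h :: l) F‖ ≤ |κ| * y + nonlinConst Γ k * (M ^ 2 * (M + y)) := by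
  have hM := hf.nonneg
  have hy : 0 ≤ y := (norm_nonneg _).trans hyf
  have df := hf.diffBounds hwf hl hyf h
  have dg := hg.diffBounds hwg hl hyg h
  have hR : ∀ a b c, a + b + c = l.length → ENNReal.ofReal (topBound k M y a) *
      ENNReal.ofReal (topBound k M y b) * ENNReal.ofReal (twoBound k M y c) ≤
      ENNReal.ofReal (4 * M ^ 2 * (M + y)) := fun a b c habc => by
    rw [← ENNReal.ofReal_mul (topBound_nonneg hM hy _), ← ENNReal.ofReal_mul
      (mul_nonneg (topBound_nonneg hM hy _) (topBound_nonneg hM hy _))]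
    exact ENNReal.ofReal_le_ofReal (topBound_mul_le hM hy (habc.trans hl))
  have n1 := df.eLpNorm_mul_mul_le df.conj df hR
  have n2 := dg.eLpNorm_mul_mul_le dg.conj df hR
  have m1 := (((df.meas.mul df.conj.meas).mul df.meas).fdiffs (h :: l)).aestronglyMeasurable
    (μ := volume)
  have m2 := (((dg.meas.mul dg.conj.meas).mul df.meas).fdiffs (h :: l)).aestronglyMeasurable
    (μ := volume)
  have m3 := (dg.meas.fdiffs (h :: l)).aestronglyMeasurable (μ := volume)
  have n3 : eLpNorm (fdiffs (h :: l) g) 2 volume ≤ ENNReal.ofReal y := by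
    rw [eLpNorm_fdiffs, diffQuots_cons, ← diffQuot_diffQuots]
    exact ENNReal.ofReal_le_ofReal (((hwg.diffQuots l).norm_diffQuot_le h).trans hyg)
  -- Writing `|f|² = f f̄` makes the nonlinearity a sum of triple products, with coefficients `Γ`
  -- and `2Γ`; this is the `3 * |Γ|` of `nonlinConst`.
  have hF' : (F : ℝ → ℂ) =ᵐ[volume] fun z => (Complex.I * κ) * g z +
      ((Complex.I * Γ) * (f z * starRingEnd ℂ (f z) * f z) +
        (Complex.I * (2 * Γ : ℝ)) * (g z * starRingEnd ℂ (g z) * f z)) := by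
    filter_upwards [hF] with z hz
    rw [hz, Complex.mul_conj', Complex.mul_conj']
    push_cast
    ring
  rw [← ENNReal.ofReal_le_ofReal_iff (by unfold nonlinConst; positivity), ← eLpNorm_fdiffs,
    eLpNorm_congr_ae (fdiffs_congr_ae hF'), fdiffs_add, fdiffs_add, fdiffs_const_mul,
    fdiffs_const_mul, fdiffs_const_mul]
  have hc : ∀ (c : ℂ) (u : ℝ → ℂ), eLpNorm (fun z => c * u z) 2 volume = ‖c‖ₑ * eLpNorm u 2 volume :=
    fun c u => eLpNorm_const_smul c u 2 volume
  have he : ∀ r : ℝ, ‖Complex.I * r‖ₑ = ENNReal.ofReal |r| := fun r => by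
    rw [← ofReal_norm, norm_mul, Complex.norm_I, one_mul, Complex.norm_real, Real.norm_eq_abs]
  refine (eLpNorm_add_le (m3.const_mul _) ((m1.const_mul _).add (m2.const_mul _))
    one_le_two).trans ?_
  refine (add_le_add le_rfl (eLpNorm_add_le (m1.const_mul _) (m2.const_mul _)
    one_le_two)).trans ?_
  rw [hc, hc, hc, he, he, he]
  calc _ ≤ ENNReal.ofReal |κ| * ENNReal.ofReal y + (ENNReal.ofReal |Γ| * (3 ^ (l.length + 1) *
        ENNReal.ofReal (4 * M ^ 2 * (M + y))) + ENNReal.ofReal |2 * Γ| * (3 ^ (l.length + 1) *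
        ENNReal.ofReal (4 * M ^ 2 * (M + y)))) := by
        gcongr
        · exact n1
        · exact n2
    _ = _ := by
      have h3 : (3 : ENNReal) = ENNReal.ofReal 3 := by norm_num
      rw [h3, ← ENNReal.ofReal_pow (by norm_num), ← ENNReal.ofReal_mul (by positivity),
        ← ENNReal.ofReal_mul (by positivity), ← ENNReal.ofReal_mul (by positivity),
        ← ENNReal.ofReal_mul (by positivity), ← ENNReal.ofReal_add (by positivity) (by positivity),
        ← ENNReal.ofReal_add (by positivity) (by positivity), hl, nonlinConst, abs_mul, abs_two]
      congr 1
      ring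

/-! ### Energy estimate for the top-order differences. -/

/-- A Grönwall inequality for a limit `Z` of functions `Y h` whose growth is controlled by `Z`. -/
theorem gronwall_of_tendsto {Z : ℝ → ℝ} {Y : ℝ → ℝ → ℝ} {T a b : ℝ} (ha : 0 ≤ a) (hb : 1 ≤ b)
    (hZ0 : 0 ≤ Z 0) (hZ : ContinuousOn Z (Icc 0 T)) (hY : ∀ h, ContinuousOn (Y h) (Icc 0 T))
    (hY0 : ∀ h, Y h 0 ≤ Z 0)
    (hd : ∀ h, ∀ t ∈ Ico 0 T, ∃ D, HasDerivWithinAt (Y h) D (Ici t) t ∧ D ≤ a + b * Z t)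
    (hlim : ∀ t ∈ Icc 0 T, Tendsto (fun h => Y h t) (𝓝[≠] 0) (𝓝 (Z t))) {t : ℝ}
    (ht : t ∈ Icc 0 T) : Z t ≤ (Z 0 + a) * Real.exp (b * T) := by
  have hT : 0 ≤ T := ht.1.trans ht.2
  -- `Z` need not be differentiable. Its majorant `V`, the integral of `a + b Z`, is; each `Y h`
  -- lies below `V`, hence so does `Z`, and `V' ≤ a + b V`. Extending `Z` by constants makes `V`
  -- differentiable at the endpoints too.
  let G : ℝ → ℝ := fun r => a + b * IccExtend hT ((Icc 0 T).domRestrict Z) r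
  have hGc : Continuous G := by
    have : Continuous (IccExtend hT ((Icc 0 T).domRestrict Z)) := hZ.domRestrict.Icc_extend'
    exact continuous_const.add (continuous_const.mul this)
  have hG : ∀ r ∈ Icc 0 T, G r = a + b * Z r := fun r hr => by
    simp only [G, IccExtend_of_mem hT _ hr, domRestrict_apply]
  let V : ℝ → ℝ := fun r => Z 0 + ∫ u in (0 : ℝ)..r, G u
  have hV : ∀ r, HasDerivAt V (G r) r := fun r =>
    (intervalIntegral.integral_hasDerivAt_right (hGc.intervalIntegrable _ _)
      (hGc.stronglyMeasurableAtFilter _ _) hGc.continuousAt).const_add _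
  have hVc : ContinuousOn V (Icc 0 T) := fun r _ => (hV r).continuousAt.continuousWithinAt
  have hV0 : V 0 = Z 0 := by simp [V]
  have hYV : ∀ h, ∀ r ∈ Icc 0 T, Y h r ≤ V r := fun h =>
    image_le_of_liminf_slope_right_le_deriv_boundary (hY h) (hV0 ▸ hY0 h) hVc
      (fun x _ => (hV x).hasDerivWithinAt) fun x hx r hr => by
        obtain ⟨D, hD, hDle⟩ := hd h x hx
        rw [← hG x (Ico_subset_Icc_self hx)] at hDle
        exact hD.liminf_right_slope_le (hDle.trans_lt hr)
  have hZV : ∀ r ∈ Icc 0 T, Z r ≤ V r := fun r hr =>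
    le_of_tendsto (hlim r hr) (Eventually.of_forall fun h => hYV h r hr)
  have key := le_gronwallBound_of_liminf_deriv_right_le (f' := G) (K := b) (ε := a) hVc
    (fun x _ r hr => by
      simpa [slope_def_module] using ((hV x).hasDerivWithinAt (s := Ici x)).liminf_right_slope_le hr)
    hV0.le (fun x hx => by
      have hx' := Ico_subset_Icc_self hx
      rw [hG x hx']
      nlinarith [hZV x hx']) t ht
  refine (hZV t ht).trans (key.trans ?_)
  rw [sub_zero, gronwallBound_of_K_ne_0 (by positivity)]
  have h1 : Real.exp (b * t) ≤ Real.exp (b * T) := by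
    gcongr
    exact ht.2
  have h2 : a / b ≤ a := div_le_self ha hb
  have h3 : 0 ≤ Real.exp (b * t) - 1 := by
    rw [sub_nonneg, Real.one_le_exp_iff]
    exact mul_nonneg (by linarith) ht.1
  have h4 : a / b * (Real.exp (b * t) - 1) ≤ a * Real.exp (b * T) :=
    mul_le_mul h2 (by linarith) h3 ha
  have h5 : Z 0 * Real.exp (b * t) ≤ Z 0 * Real.exp (b * T) := mul_le_mul_of_nonneg_left h1 hZ0
  linarith

/-- With `S = y₁ + y₂` the left side is at most `2 S N`. The term `2 c M³ S` is split as `(c M³)² +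
S²`, and `S² ≤ 2 (y₁² + y₂²)`. -/
theorem energy_rate_le {K c N M y₁ y₂ x₁ x₂ F₁ F₂ : ℝ} (hK : 0 ≤ K) (hc : 0 ≤ c) (hM : 0 ≤ M)
    (hx₁ : 0 ≤ x₁) (hx₂ : 0 ≤ x₂) (h₁ : x₁ ≤ y₁) (h₂ : x₂ ≤ y₂)
    (hN : N = K * (y₁ + y₂) + c * (M ^ 2 * (M + (y₁ + y₂)))) (hF₁ : F₁ ≤ N) (hF₂ : F₂ ≤ N) :
    2 * (x₁ * F₁) + 2 * (x₂ * F₂) ≤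
      (c * M ^ 3) ^ 2 + 2 * (2 * K + 2 * c * M ^ 2 + 1) * (y₁ ^ 2 + y₂ ^ 2) := by
  have hy : 0 ≤ y₁ + y₂ := by linarith
  have hN0 : 0 ≤ N := by rw [hN]; positivity
  have e1 : x₁ * F₁ ≤ y₁ * N := (mul_le_mul_of_nonneg_left hF₁ hx₁).trans (by gcongr)
  have e2 : x₂ * F₂ ≤ y₂ * N := (mul_le_mul_of_nonneg_left hF₂ hx₂).trans (by gcongr)
  have e3 : (y₁ + y₂) ^ 2 ≤ 2 * (y₁ ^ 2 + y₂ ^ 2) := by nlinarith [sq_nonneg (y₁ - y₂)]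
  have e4 : 0 ≤ 2 * K + 2 * c * M ^ 2 + 1 := by positivity
  have e5 := mul_le_mul_of_nonneg_left e3 e4
  have e6 := sq_nonneg (c * M ^ 3 - (y₁ + y₂))
  subst hN
  nlinarith

namespace IsNLCMESolutionOn

variable {v κ Γ T : ℝ} {Ep Em : ℝ → L2C}

/-- The differences of `Ep` are differentiable in time in `L²`, whereas those of its weak derivative
need not be. Transport contributes nothing, since a function is orthogonal to its derivative. -/
theorem exists_hasDerivWithinAt_sq_norm (h : IsNLCMESolutionOn v κ Γ (Icc 0 T) Ep Em) {k : ℕ}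
    {M y t : ℝ} (ht : t ∈ Ico 0 T) (hp : StageBound k M (Ep t)) (hm : StageBound k M (Em t))
    {l : List ℝ} (hl : l.length = k) (hyp : ‖diffQuots l (weakDeriv (Ep t))‖ ≤ y)
    (hym : ‖diffQuots l (weakDeriv (Em t))‖ ≤ y) (r : ℝ) :
    ∃ D, HasDerivWithinAt (fun t => ‖diffQuots (r :: l) (Ep t)‖ ^ 2) D (Ici t) t ∧
      ∃ F, F ≤ |κ| * y + nonlinConst Γ k * (M ^ 2 * (M + y)) ∧
        D ≤ 2 * (‖diffQuots (r :: l) (Ep t)‖ * F) := by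
  have ht' := Ico_subset_Icc_self ht
  obtain ⟨F, hF, hFe⟩ := h.exists_hasDerivWithinAt ht'
  have hw := h.hasWeakDeriv ht'
  have hd := (((diffQuots (r :: l)).restrictScalars ℝ).hasFDerivAt.comp_hasDerivWithinAt t
    (hF.mono_of_mem_nhdsWithin (Icc_mem_nhdsGE_of_mem ht))).norm_sq
  refine ⟨_, hd, ‖diffQuots (r :: l) F‖,
    norm_diffQuots_nonlin_le hp hm hw (h.swap.hasWeakDeriv ht') hl hyp hym hFe r, ?_⟩
  have h0 := (hw.diffQuots (r :: l)).inner_self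
  simp only [map_sub, map_smul, Function.comp_apply, ContinuousLinearMap.coe_restrictScalars']
  rw [inner_sub_right, real_inner_smul_right, h0, mul_zero, sub_zero]
  gcongr
  exact real_inner_le_norm _ _

/-- If the solution satisfies the bounds of stage `k`, then the next differences of its weak
derivatives grow at most exponentially. -/
theorem sq_norm_diffQuots_le (h : IsNLCMESolutionOn v κ Γ (Icc 0 T) Ep Em) {k : ℕ} {M : ℝ}
    (hp : ∀ t ∈ Icc 0 T, StageBound k M (Ep t)) (hm : ∀ t ∈ Icc 0 T, StageBound k M (Em t))
    {l : List ℝ} (hl : l.length = k) {t : ℝ} (ht : t ∈ Icc 0 T) :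
    ‖diffQuots l (weakDeriv (Ep t))‖ ^ 2 + ‖diffQuots l (weakDeriv (Em t))‖ ^ 2 ≤
      (‖diffQuots l (weakDeriv (Ep 0))‖ ^ 2 + ‖diffQuots l (weakDeriv (Em 0))‖ ^ 2 +
        (nonlinConst Γ k * M ^ 3) ^ 2) *
        Real.exp (2 * (2 * |κ| + 2 * nonlinConst Γ k * M ^ 2 + 1) * T) := by
  have hM := (hp t ht).nonneg
  have hc : 0 ≤ nonlinConst Γ k := by unfold nonlinConst; positivity
  have h0 : (0 : ℝ) ∈ Icc 0 T := ⟨le_rfl, ht.1.trans ht.2⟩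
  have hle : ∀ r, ∀ s ∈ Icc 0 T,
      ‖diffQuots (r :: l) (Ep s)‖ ≤ ‖diffQuots l (weakDeriv (Ep s))‖ ∧
      ‖diffQuots (r :: l) (Em s)‖ ≤ ‖diffQuots l (weakDeriv (Em s))‖ := fun r s hs => by
    rw [diffQuots_cons, diffQuots_cons, ← diffQuot_diffQuots, ← diffQuot_diffQuots]
    exact ⟨((h.hasWeakDeriv hs).diffQuots l).norm_diffQuot_le r,
      ((h.swap.hasWeakDeriv hs).diffQuots l).norm_diffQuot_le r⟩
  have hcont : ∀ (l : List ℝ) (E : ℝ → L2C), ContinuousOn E (Icc 0 T) →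
      ContinuousOn (fun s => ‖diffQuots l (E s)‖ ^ 2) (Icc 0 T) := fun l E hE =>
    ((diffQuots l).continuous.comp_continuousOn hE).norm.pow 2
  -- The extra step `r` serves as the parameter tending to 0: the quotient converges to the weak
  -- derivative and is bounded by it in norm.
  refine gronwall_of_tendsto
    (Z := fun s => ‖diffQuots l (weakDeriv (Ep s))‖ ^ 2 + ‖diffQuots l (weakDeriv (Em s))‖ ^ 2)
    (Y := fun r s => ‖diffQuots (r :: l) (Ep s)‖ ^ 2 + ‖diffQuots (r :: l) (Em s)‖ ^ 2)
    (sq_nonneg _) ?_ (by positivity)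
    ((hcont _ _ h.continuousOn_deriv_p).add (hcont _ _ h.continuousOn_deriv_m))
    (fun r => (hcont _ _ h.continuousOn_p).add (hcont _ _ h.continuousOn_m)) ?_ ?_ ?_ ht
  · nlinarith [abs_nonneg κ, mul_nonneg hc (sq_nonneg M)]
  · intro r
    have := hle r 0 h0
    gcongr
    exacts [this.1, this.2]
  · intro r s hs
    have hs' := Ico_subset_Icc_self hs
    have hy₁ := norm_nonneg (diffQuots l (weakDeriv (Ep s)))
    have hy₂ := norm_nonneg (diffQuots l (weakDeriv (Em s)))
    obtain ⟨D₁, hD₁, F₁, hF₁, hDF₁⟩ := h.exists_hasDerivWithinAt_sq_norm hs (hp s hs') (hm s hs')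
      hl (le_add_of_nonneg_right hy₂) (le_add_of_nonneg_left hy₁) r
    obtain ⟨D₂, hD₂, F₂, hF₂, hDF₂⟩ := h.swap.exists_hasDerivWithinAt_sq_norm hs (hm s hs')
      (hp s hs') hl (le_add_of_nonneg_left hy₁) (le_add_of_nonneg_right hy₂) r
    exact ⟨_, hD₁.add hD₂, (add_le_add hDF₁ hDF₂).trans (energy_rate_le (abs_nonneg κ) hc hM
      (norm_nonneg _) (norm_nonneg _) (hle r s hs').1 (hle r s hs').2 rfl hF₁ hF₂)⟩
  · intro s hs
    simp only [diffQuots_cons, ← diffQuot_diffQuots]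
    exact (((h.hasWeakDeriv hs).diffQuots l).tendsto_diffQuot.norm.pow 2).add
      (((h.swap.hasWeakDeriv hs).diffQuots l).tendsto_diffQuot.norm.pow 2)

end IsNLCMESolutionOn

/-! ### Induction on the order and conclusion. -/

theorem norm_iterate_weakDeriv_le_hsNorm {s k : ℕ} (hk : k ≤ s) (f₁ f₂ : L2C) :
    ‖weakDeriv^[k] f₁‖ ≤ hsNorm s f₁ f₂ ∧ ‖weakDeriv^[k] f₂‖ ≤ hsNorm s f₁ f₂ := by
  have h := Finset.single_le_sum
    (f := fun k => ‖weakDeriv^[k] f₁‖ ^ 2 + ‖weakDeriv^[k] f₂‖ ^ 2)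
    (fun i _ => by positivity) (Finset.mem_range.2 (Nat.lt_succ_of_le hk))
  constructor <;> refine Real.le_sqrt_of_sq_le (le_trans ?_ h)
  · exact le_add_of_nonneg_right (sq_nonneg _)
  · exact le_add_of_nonneg_left (sq_nonneg _)

theorem hsNorm_le {s : ℕ} {f₁ f₂ : L2C} {M : ℝ} (hM : 0 ≤ M)
    (h₁ : ∀ j ≤ s, ‖weakDeriv^[j] f₁‖ ≤ M) (h₂ : ∀ j ≤ s, ‖weakDeriv^[j] f₂‖ ≤ M) :
    hsNorm s f₁ f₂ ≤ Real.sqrt (2 * (s + 1)) * M := by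
  rw [hsNorm, Real.sqrt_le_left (by positivity), mul_pow, Real.sq_sqrt (by positivity)]
  refine (Finset.sum_le_card_nsmul _ _ (2 * M ^ 2) fun j hj => ?_).trans (le_of_eq ?_)
  · have hj' := Nat.lt_succ_iff.1 (Finset.mem_range.1 hj)
    have e1 := pow_le_pow_left₀ (norm_nonneg _) (h₁ j hj') 2
    have e2 := pow_le_pow_left₀ (norm_nonneg _) (h₂ j hj') 2
    linarith
  · rw [Finset.card_range, nsmul_eq_mul]
    push_cast
    ring

/-- The bound for the next stage: `x` bounds the initial `H^s` norm, `M` the current stage. -/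
noncomputable def nextBound (κ Γ : ℝ) (k : ℕ) (T x M : ℝ) : ℝ :=
  M + Real.sqrt ((x ^ 2 + x ^ 2 + (nonlinConst Γ k * M ^ 3) ^ 2) *
    Real.exp (2 * (2 * |κ| + 2 * nonlinConst Γ k * M ^ 2 + 1) * T))

theorem tendsto_nextBound (κ Γ : ℝ) (k : ℕ) (T : ℝ) {M : ℝ → ℝ}
    (hM : Tendsto M (𝓝[≥] 0) (𝓝 0)) :
    Tendsto (fun x => nextBound κ Γ k T x (M x)) (𝓝[≥] 0) (𝓝 0) := by
  have hc : Continuous fun p : ℝ × ℝ => nextBound κ Γ k T p.1 p.2 := by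
    unfold nextBound
    fun_prop
  have h0 : nextBound κ Γ k T 0 0 = 0 := by simp [nextBound]
  have := (hc.tendsto (0, 0)).comp
    ((tendsto_id.mono_left (nhdsWithin_le_nhds (s := Ici (0 : ℝ)))).prodMk_nhds hM)
  rw [h0] at this
  exact this

/-- Only the derivative's differences of order exactly `k` are new: a difference of `f` of order `k
+ 1` is controlled by one of its derivative of order `k`. -/
theorem StageBound.succ {k : ℕ} {M N : ℝ} {f : L2C} (hf : StageBound k M f)
    (hw : HasWeakDeriv f (weakDeriv f)) (hMN : M ≤ N)
    (hN : ∀ l : List ℝ, l.length = k → ‖diffQuots l (weakDeriv f)‖ ≤ N) :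
    StageBound (k + 1) N f := by
  have hd : ∀ l : List ℝ, l.length < k + 1 → ‖diffQuots l (weakDeriv f)‖ ≤ N := fun l hl => by
    rcases (Nat.lt_succ_iff.1 hl).lt_or_eq with h | h
    · exact (hf.diff_deriv l h).trans hMN
    · exact hN l h
  refine ⟨fun l hl => ?_, hd, hf.top.mono fun z hz => hz.trans hMN⟩
  cases l with
  | nil => exact (hf.diff [] (by simp)).trans hMN
  | cons h l =>
    rw [diffQuots_cons, ← diffQuot_diffQuots]
    exact ((hw.diffQuots l).norm_diffQuot_le h).trans (hd l (by simpa using hl))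

/-- The a priori bounds, by induction on the order of the differences. -/
theorem exists_stageBound (v κ Γ : ℝ) {s : ℕ} (hs : 1 ≤ s) (k : ℕ) (hk : k ≤ s) :
    ∃ C : ℝ → ℝ → ℝ, (∀ T : ℝ, Tendsto (fun x => C x T) (𝓝[≥] 0) (𝓝 0)) ∧
      ∀ (T : ℝ) (Ep Em : ℝ → L2C), IsNLCMESolutionOn v κ Γ (Icc 0 T) Ep Em →
        MemHs s (Ep 0) → MemHs s (Em 0) → ∀ t ∈ Icc 0 T,
          StageBound k (C (hsNorm s (Ep 0) (Em 0)) T) (Ep t) ∧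
          StageBound k (C (hsNorm s (Ep 0) (Em 0)) T) (Em t) := by
  induction k with
  | zero =>
    -- The factor 4 counts the norms of the two components and of their derivatives, each at most
    -- `x`; this is where `1 ≤ s` enters.
    refine ⟨fun x T => Real.exp (|κ| * T) * (4 * x), fun T => ?_, ?_⟩
    · refine Tendsto.mono_left ?_ nhdsWithin_le_nhds
      have : Continuous fun x : ℝ => Real.exp (|κ| * T) * (4 * x) := by fun_prop
      simpa using this.tendsto 0
    · intro T Ep Em h hp hm t ht
      have h0 := norm_iterate_weakDeriv_le_hsNorm (Nat.zero_le s) (Ep 0) (Em 0)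
      have h1 := norm_iterate_weakDeriv_le_hsNorm hs (Ep 0) (Em 0)
      simp only [Function.iterate_zero, Function.iterate_one, id_eq] at h0 h1
      have hb : ∀ f : L2C, ∀ B : ℝ, ‖f‖ ≤ B ∧ (∀ᵐ z, ‖f z‖ ≤ B) → StageBound 0 B f :=
        fun f B hf => ⟨fun l hl => by
          rw [List.length_eq_zero_iff.1 (Nat.le_zero.1 hl)]
          exact hf.1, fun l hl => absurd hl (Nat.not_lt_zero _), hf.2⟩
      exact ⟨hb _ _ (h.bounds (by linarith) ht), hb _ _ (h.swap.bounds (by linarith) ht)⟩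
  | succ k ih =>
    obtain ⟨C, hC, hB⟩ := ih (by lia)
    refine ⟨fun x T => nextBound κ Γ k T x (C x T), fun T => tendsto_nextBound κ Γ k T (hC T), ?_⟩
    intro T Ep Em h hp hm t ht
    have hst := hB T Ep Em h hp hm
    have hinit := norm_iterate_weakDeriv_le_hsNorm hk (Ep 0) (Em 0)
    set x := hsNorm s (Ep 0) (Em 0)
    have hle : ∀ l : List ℝ, l.length = k →
        ‖diffQuots l (weakDeriv (Ep t))‖ ^ 2 + ‖diffQuots l (weakDeriv (Em t))‖ ^ 2 ≤
          (x ^ 2 + x ^ 2 + (nonlinConst Γ k * C x T ^ 3) ^ 2) *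
            Real.exp (2 * (2 * |κ| + 2 * nonlinConst Γ k * C x T ^ 2 + 1) * T) := by
      intro l hl
      have h0 : ∀ f : L2C, MemHs s f → ‖weakDeriv^[k + 1] f‖ ≤ x →
          ‖diffQuots l (weakDeriv f)‖ ≤ x := fun f hf hfx => by
        rw [Function.iterate_succ_apply, ← hl] at hfx
        exact (MemHs.norm_diffQuots_le (hl ▸ (hf.of_le hk).weakDeriv)).trans hfx
      refine (h.sq_norm_diffQuots_le (fun t ht => (hst t ht).1) (fun t ht => (hst t ht).2)
        hl ht).trans ?_
      gcongr
      · exact h0 _ hp hinit.1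
      · exact h0 _ hm hinit.2
    have hM : C x T ≤ nextBound κ Γ k T x (C x T) :=
      le_add_of_nonneg_right (Real.sqrt_nonneg _)
    have hM0 := (hst t ht).1.nonneg
    have hsqrt : ∀ y z : ℝ, y ^ 2 ≤ z → y ≤ C x T + Real.sqrt z := fun y z hyz =>
      (Real.le_sqrt_of_sq_le hyz).trans (le_add_of_nonneg_left hM0)
    exact ⟨(hst t ht).1.succ (h.hasWeakDeriv ht) hM fun l hl => hsqrt _ _
        ((le_add_of_nonneg_right (sq_nonneg _)).trans (hle l hl)),
      (hst t ht).2.succ (h.swap.hasWeakDeriv ht) hM fun l hl => hsqrt _ _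
        ((le_add_of_nonneg_left (sq_nonneg _)).trans (hle l hl))⟩

theorem mainTheorem4 (v κ Γ : ℝ) (s : ℕ) (hs : 1 ≤ s) :
    ∃ C : ℝ → ℝ → ℝ,
      (∀ T : ℝ, 0 ≤ T → Tendsto (fun x => C x T) (𝓝[≥] 0) (𝓝 0)) ∧
      ∀ (T : ℝ), 0 ≤ T → ∀ (Ep Em : ℝ → L2C),
        IsNLCMESolutionOn v κ Γ (Icc 0 T) Ep Em →
        MemHs s (Ep 0) → MemHs s (Em 0) →
        MemHs s (Ep T) ∧ MemHs s (Em T) ∧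
          hsNorm s (Ep T) (Em T) ≤ C (hsNorm s (Ep 0) (Em 0)) T := by
  obtain ⟨C, hC, hB⟩ := exists_stageBound v κ Γ hs s le_rfl
  refine ⟨fun x T => Real.sqrt (2 * (s + 1)) * C x T, fun T _ => ?_, ?_⟩
  · simpa using (hC T).const_mul (Real.sqrt (2 * (s + 1)))
  · intro T hT Ep Em h hp hm
    obtain ⟨bp, bm⟩ := hB T Ep Em h hp hm T ⟨hT, le_rfl⟩
    have mp := memHs_of_norm_diffQuots_le bp.diff
    have mm := memHs_of_norm_diffQuots_le bm.diff
    exact ⟨mp.1, mm.1, hsNorm_le bp.nonneg mp.2 mm.2⟩
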